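/- Let $E$ be a separable real Hilbert space and let $C\subset E\times E$ be a (possibly nonlinear, multivalued) $m$-dissipative operator, i.e. $\langle x_1-x_2,y_1-y_2\rangle\le 0$ for all $(x_i,y_i)\in C$ and $\mathcal R(I-\alpha C)=E$ for all $\alpha>0$. Assume that $\mathcal D(C)=\{x:\exists y,\ (x,y)\in C\}$ is dense in $E$ and $(0,0)\in C$. For $\xi\in\mathcal D(C)$ let $C^0\xi$ be the element of minimal norm of $C\xi$; let $S(t)$ be the semigroup generated by $C$, $S(0)x=x$ and $S(t)x=\lim_{n\to\infty}(I-\frac tn C)^{-n}x$ for $t>0$; and let $d_C(x,y)=\inf\{t+\|x-S(t)y\|:t\ge 0\}$ be the Tataru distance function. Let $G:E\times E\to\mathbb R$ satisfy the following condition. (1) $G$ is continuous. For every $\lambda>1$ there is a continuous $\rho_\lambda:[0,\infty)\to\mathbb R$ with $\rho_\lambda(0)=0$ such that $$\lambda G\Big(x,\frac{\mu(x-y)}{\lambda}\Big)-G(y,\mu(x-y))\le\rho_\lambda\big(\|x-y\|+\mu\|x-y\|^2\big)\qquad\text{for all }x,y\in E,\ \mu>0,$$ and for every $M>0$ there is a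 continuous $\sigma_M:[0,\infty)\to\mathbb R$ with $\sigma_M(0)=0$ such that $|G(x,p)-G(x,q)|\le\sigma_M(r)$ whenever $r\ge0$, $\|x\|+\|p\|+\|q\|<M$ and $\|q-p\|\le r$. (2) There is a nondecreasing $\varphi\in C^1([0,\infty))$ with $\varphi\ge0$, $\varphi'>0$, $\lim_{r\to\infty}\varphi(r)=\infty$ and $\sup_{r\ge0}\big(|r\varphi'(r^2)|+|r\varphi'(r)|\big)<\infty$ such that for all $M>0$ and $\lambda>1$ there is a continuous $\gamma_{\lambda,M}:[0,\infty)\to\mathbb R$ with $\gamma_{\lambda,M}(0)=0$ and $$\lambda G\Big(x,\frac{p+\varepsilon\varphi'(\|x\|^2)x}{\lambda}\Big)-G(x,p)\le\gamma_{\lambda,M}(\varepsilon)\qquad\text{for all }x\in E,\ \|p\|\le M,\ \varepsilon>0.$$ Define operators $\hat H_0,\hat H_1$, identified with their graphs, as follows. For $\mu,\rho>0$, $\xi\in\mathcal D(C)$, $y\in E$, put $g(x)=\frac\mu2\|x-\xi\|^2$, $f(x)=g(x)+\rho\, d_C(x,y)$ and $$\hat H_0f(x)=\mu\langle x-\xi,C^0\xi\rangle+\rho+\sup_{\|q\|\le\rho}G(x,Dg(x)+q);$$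 likewise put $g(x)=-\frac\mu2\|x-\xi\|^2$, $f(x)=g(x)-\rho\, d_C(x,y)$ and $$\hat H_1f(x)=-\mu\langle x-\xi,C^0\xi\rangle-\rho+\inf_{\|q\|\le\rho}G(x,Dg(x)+q).$$ Let $\alpha>0$ and let $h:E\to\mathbb R$ be bounded and uniformly continuous. Call $\bar f:E\to\mathbb R$ a (Tataru–Crandall–Lions) subsolution of $(I-\alpha\hat H_0)f=h$ if it is bounded and upper semicontinuous and, for every $(f_0,\hat H_0f_0)\in\hat H_0$ and every $x_0\in E$ with $(\bar f-f_0)(x_0)=\sup_{E}(\bar f-f_0)$, one has $\alpha^{-1}(\bar f-h)(x_0)\le\limsup_{x\to x_0}\hat H_0f_0(x)$. Call $\underline f:E\to\mathbb R$ a supersolution of $(I-\alpha\hat H_1)f=h$ if it is bounded and lower semicontinuous and, for every $(f_0,\hat H_1f_0)\in\hat H_1$ and every $x_0\in E$ with $(f_0-\underline f)(x_0)=\sup_{E}(f_0-\underline f)$, one has $\alpha^{-1}(\underline f-h)(x_0)\ge\liminf_{x\to x_0}\hat H_1f_0(x)$. (Here $\limsup_{x\to x_0}$ and $\liminf_{x\to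 x_0}$ include $x=x_0$.) Then every subsolution $\bar f$ of $(I-\alpha\hat H_0)f=h$ and every supersolution $\underline f$ of $(I-\alpha\hat H_1)f=h$ satisfy $\bar f(x)\le\underline f(x)$ for all $x\in E$. -/

import Mathlib

open Set Filter Topology
open scoped NNReal

namespace TataruHJ

noncomputable section

variable {E : Type*} [NormedAddCommGroup E] [InnerProductSpace ℝ E]

/-! ### Multivalued dissipative operators, identified with their graphs `C ⊆ E × E` -/

/-- The domain `𝓓(C)` of a multivalued operator. -/
def domain (C : Set (E × E)) : Set E := {x | ∃ y, (x, y) ∈ C}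

/-- `⟨x₁ - x₂, y₁ - y₂⟩ ≤ 0` for all `(x₁, y₁), (x₂, y₂) ∈ C`. -/
def IsDissipative (C : Set (E × E)) : Prop :=
  ∀ x₁ y₁ x₂ y₂ : E, (x₁, y₁) ∈ C → (x₂, y₂) ∈ C → inner ℝ (x₁ - x₂) (y₁ - y₂) ≤ 0

/-- `C` is dissipative and the range of `I - αC` is all of `E` for every `α > 0`. -/
def IsMDissipative (C : Set (E × E)) : Prop :=
  IsDissipative C ∧ ∀ α : ℝ, 0 < α → ∀ x : E, ∃ y z : E, (y, z) ∈ C ∧ y - α • z = x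

/-- The canonical restriction `C⁰` of `C` (as a graph): all `(x, z) ∈ C` such that `z` has minimal
norm among the elements of `Cx`. -/
def canonicalRestriction (C : Set (E × E)) : Set (E × E) :=
  {p | p ∈ C ∧ ∀ w : E, (p.1, w) ∈ C → ‖p.2‖ ≤ ‖w‖}

open Classical in
/-- The resolvent `(I - αC)⁻¹ x`: a point `y` with `x ∈ y - α C y`. For `m`-dissipative `C` and
`α > 0` such a `y` exists and is unique; the default value `0` is never used then. -/
def resolventMap (C : Set (E × E)) (α : ℝ) (x : E) : E :=
  if hx : ∃ y z : E, (y, z) ∈ C ∧ y - α • z = x then hx.choose else 0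

/-- The semigroup generated by `C`, through the exponential formula
`S(t) x = lim_{n → ∞} (I - (t / n) C)⁻ⁿ x` for `t > 0`, and `S(0) x = x`. (For an `m`-dissipative
densely defined `C` the limit exists for every `t > 0` and `x`. Negative `t` is never used.) -/
def semigroup (C : Set (E × E)) (t : ℝ) (x : E) : E :=
  if t ≤ 0 then x else limUnder atTop (fun n : ℕ => (resolventMap C (t / n))^[n] x)

/-- The Tataru distance function `d_C(x, y) = inf {t + ‖x - S(t) y‖ : t ≥ 0}`. -/
def tataruDist (C : Set (E × E)) (x y : E) : ℝ :=
  ⨅ t : ℝ≥0, ((t : ℝ) + ‖x - semigroup C t y‖)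

/-! ### Viscosity solutions of `(I - αH) f = h` for an operator `H` given by its graph

An element of the graph is a pair `(f₀, H f₀)`. The second entry takes values in `EReal`, so that
suprema, infima, limsup and liminf have no junk values. -/

/-- Tataru–Crandall–Lions subsolution. `limsup g₀ (𝓝 x₀)` is the upper semicontinuous
smoothing `(g₀)^*` at `x₀`. -/
def IsSubsolution (H : Set ((E → ℝ) × (E → EReal))) (α : ℝ) (h f : E → ℝ) : Prop :=
  (∃ K : ℝ, ∀ x, |f x| ≤ K) ∧ UpperSemicontinuous f ∧
    ∀ (x₀ : E) (f₀ : E → ℝ) (g₀ : E → EReal), (f₀, g₀) ∈ H →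
      (∀ x, f x - f₀ x ≤ f x₀ - f₀ x₀) →
        ((α⁻¹ * (f x₀ - h x₀) : ℝ) : EReal) ≤ limsup g₀ (𝓝 x₀)

/-- Tataru–Crandall–Lions supersolution. `liminf g₀ (𝓝 x₀)` is the lower semicontinuous
smoothing `(g₀)_*` at `x₀`. -/
def IsSupersolution (H : Set ((E → ℝ) × (E → EReal))) (α : ℝ) (h f : E → ℝ) : Prop :=
  (∃ K : ℝ, ∀ x, |f x| ≤ K) ∧ LowerSemicontinuous f ∧
    ∀ (x₀ : E) (f₀ : E → ℝ) (g₀ : E → EReal), (f₀, g₀) ∈ H →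
      (∀ x, f₀ x - f x ≤ f₀ x₀ - f x₀) →
        liminf g₀ (𝓝 x₀) ≤ ((α⁻¹ * (f x₀ - h x₀) : ℝ) : EReal)

/-! ### The operators `Ĥ₀` and `Ĥ₁` -/

/-- `x ↦ (c / 2) ‖x - ξ‖²`. -/
def quad (c : ℝ) (ξ x : E) : ℝ := c / 2 * ‖x - ξ‖ ^ 2

/-- The graph of `Ĥ₀`: for `g(x) = (μ/2) ‖x - ξ‖²` and `f(x) = g(x) + ρ d_C(x, y)` with
`μ, ρ > 0`, `ξ ∈ 𝓓(C)`, `y ∈ E`,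
`Ĥ₀ f(x) = μ ⟨x - ξ, C⁰ξ⟩ + ρ + sup_{‖q‖ ≤ ρ} G(x, Dg(x) + q)`. Here `ζ` is `C⁰ξ`. -/
def H₀hat [CompleteSpace E] (C : Set (E × E)) (G : E → E → ℝ) :
    Set ((E → ℝ) × (E → EReal)) :=
  {F | ∃ (μ ρ : ℝ) (ξ ζ y : E), 0 < μ ∧ 0 < ρ ∧ (ξ, ζ) ∈ canonicalRestriction C ∧
    F.1 = (fun x => quad μ ξ x + ρ * tataruDist C x y) ∧
    F.2 = (fun x => ((μ * inner ℝ (x - ξ) ζ + ρ : ℝ) : EReal) +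
      ⨆ q ∈ Metric.closedBall (0 : E) ρ, ((G x (gradient (quad μ ξ) x + q) : ℝ) : EReal))}

/-- The graph of `Ĥ₁`: for `g(x) = -(μ/2) ‖x - ξ‖²` and `f(x) = g(x) - ρ d_C(x, y)` with
`μ, ρ > 0`, `ξ ∈ 𝓓(C)`, `y ∈ E`,
`Ĥ₁ f(x) = -μ ⟨x - ξ, C⁰ξ⟩ - ρ + inf_{‖q‖ ≤ ρ} G(x, Dg(x) + q)`. Here `ζ` is `C⁰ξ`. -/
def H₁hat [CompleteSpace E] (C : Set (E × E)) (G : E → E → ℝ) :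
    Set ((E → ℝ) × (E → EReal)) :=
  {F | ∃ (μ ρ : ℝ) (ξ ζ y : E), 0 < μ ∧ 0 < ρ ∧ (ξ, ζ) ∈ canonicalRestriction C ∧
    F.1 = (fun x => quad (-μ) ξ x - ρ * tataruDist C x y) ∧
    F.2 = (fun x => ((-μ * inner ℝ (x - ξ) ζ - ρ : ℝ) : EReal) +
      ⨅ q ∈ Metric.closedBall (0 : E) ρ, ((G x (gradient (quad (-μ) ξ) x + q) : ℝ) : EReal))}

/-! ### The structural condition on `G` -/

/-- A modulus: a real function, continuous on `[0, ∞)`, which vanishes at `0`. -/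
def IsModulus (ω : ℝ → ℝ) : Prop := ContinuousOn ω (Ici 0) ∧ ω 0 = 0

/-- A positive nondecreasing `C¹` function on `[0, ∞)` that grows slowly to infinity. The
derivative on `[0, ∞)` (one-sided at `0`) is `derivWithin φ (Ici 0)`. -/
def IsSlowlyGrowing (φ : ℝ → ℝ) : Prop :=
  ContDiffOn ℝ 1 φ (Ici 0) ∧ MonotoneOn φ (Ici 0) ∧ (∀ r, 0 ≤ r → 0 ≤ φ r) ∧
    (∀ r, 0 ≤ r → 0 < derivWithin φ (Ici 0) r) ∧ Tendsto φ atTop atTop ∧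
    ∃ K : ℝ, ∀ r, 0 ≤ r →
      |r * derivWithin φ (Ici 0) (r ^ 2)| + |r * derivWithin φ (Ici 0) r| ≤ K

/-- The structural condition on the nonlinearity `G`. -/
structure StructuralCondition (G : E → E → ℝ) : Prop where
  continuous : Continuous (fun z : E × E => G z.1 z.2)
  doubling : ∀ l : ℝ, 1 < l → ∃ ω : ℝ → ℝ, IsModulus ω ∧ ∀ (μ : ℝ) (x y : E), 0 < μ →
    l * G x (l⁻¹ • μ • (x - y)) - G y (μ • (x - y)) ≤ ω (‖x - y‖ + μ * ‖x - y‖ ^ 2)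
  momentum : ∀ M : ℝ, 0 < M → ∃ ω : ℝ → ℝ, IsModulus ω ∧ ∀ (r : ℝ) (x p q : E), 0 ≤ r →
    ‖x‖ + ‖p‖ + ‖q‖ < M → ‖q - p‖ ≤ r → |G x p - G x q| ≤ ω r
  growth : ∃ φ : ℝ → ℝ, IsSlowlyGrowing φ ∧ ∀ M l : ℝ, 0 < M → 1 < l →
    ∃ ω : ℝ → ℝ, IsModulus ω ∧ ∀ (ε : ℝ) (x p : E), 0 < ε → ‖p‖ ≤ M →
      l * G x (l⁻¹ • (p + (ε * derivWithin φ (Ici 0) (‖x‖ ^ 2)) • x)) - G x p ≤ ω ε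

end

end TataruHJ

/-! Doubling of variables cannot be applied directly: the test functions of `H₀hat` and `H₁hat` are
quadratics centred at a point of the domain of `C`, whereas the usual doubling centres them at the
other maximum point, which need not lie there. So a third variable `ξ` is inserted between `x` and
`y`, and one maximizes `l²u(x) - v(y) - (a/2)‖x-ξ‖² - (b/2)‖ξ-y‖² - εφ(‖ξ‖²)`, where `u` and `v` are
the sub- and the supersolution.

Subtracting a small multiple of `sup_h ‖yosida C h ξ‖`, which is finite only on the domain of `C`,
forces `ξ` into the domain. Maxima need not exist, so Ekeland's principle is applied with the Tataru
distance as perturbation, which is exactly the perturbation allowed in the test functions. It works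
because `tataruDist` satisfies the triangle inequality and its forward Cauchy sequences are
relatively compact; both facts come from the contraction semigroup, built with Kobayashi's estimate.

At the point found (`exists_doubled_max`) the `ξ`-gradient of the functional is small, and so is its
product with `ζ = C⁰ξ`, from above. Both quadratics have the same centre `ξ`, so the `C`-terms of
the two viscosity inequalities combine into `⟨gradient, ζ⟩ + 2εφ'(‖ξ‖²)⟨ξ, ζ⟩`, and the second term
is nonpositive because `(0, 0) ∈ C`. Taking `a` large glues `ξ` to `x`, leaving an inequality for
`G` alone (`exists_quasi_optimal`).

The factor `l²` with `l > 1` pays for the two structural conditions, one `l` each: the growth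
condition removes `φ'`, and the doubling condition compares `G` at `x` and at `y`. The resulting
bound contradicts `u(z) > v(z)` at any point `z`. -/

namespace TataruHJ

/-! ### Resolvents, Yosida approximations and Kobayashi's estimate. -/

section Resolvent

variable {E : Type*} [NormedAddCommGroup E] [InnerProductSpace ℝ E] {C : Set (E × E)}

/-- The Yosida approximation `α⁻¹ (J_α - I)`, where `J_α = (I - αC)⁻¹`. -/
noncomputable def yosida (C : Set (E × E)) (α : ℝ) (x : E) : E :=
  α⁻¹ • (resolventMap C α x - x)

lemma resolventMap_eq_add {α : ℝ} (hα : 0 < α) (x : E) :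
    resolventMap C α x = x + α • yosida C α x := by
  rw [yosida, smul_smul, mul_inv_cancel₀ hα.ne', one_smul]; abel

lemma IsMDissipative.yosida_mem (hC : IsMDissipative C) {α : ℝ} (hα : 0 < α) (x : E) :
    (resolventMap C α x, yosida C α x) ∈ C := by
  have hx := hC.2 α hα x
  have hr : resolventMap C α x = hx.choose := by rw [resolventMap, dif_pos hx]
  obtain ⟨z, hz, hz'⟩ := hx.choose_spec
  rw [← hr] at hz hz'
  have : yosida C α x = z := by
    rw [yosida]
    nth_rewrite 2 [← hz']
    rw [sub_sub_cancel, smul_smul, inv_mul_cancel₀ hα.ne', one_smul]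
  rwa [this]

/-- The two-step-size inequality behind Kobayashi's estimate. -/
lemma IsDissipative.add_mul_norm_sub_le (hC : IsDissipative C) {x y w w' : E} {l μ : ℝ}
    (hl : 0 < l) (hμ : 0 < μ) (hx : (x, w) ∈ C) (hy : (y, w') ∈ C) :
    (l + μ) * ‖x - y‖ ≤ l * ‖x - (y - μ • w')‖ + μ * ‖x - l • w - y‖ := by
  have h := hC x w y w' hx hy
  -- The combination equals `(l + μ)(x - y) - lμ(w - w')`, so pairing it with `x - y` brings in the
  -- dissipativity inequality with a favourable sign.
  have e : inner ℝ (x - y) (l • (x - (y - μ • w')) + μ • (x - l • w - y)) =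
      (l + μ) * ‖x - y‖ ^ 2 - l * μ * inner ℝ (x - y) (w - w') := by
    have : l • (x - (y - μ • w')) + μ • (x - l • w - y) =
        (l + μ) • (x - y) - (l * μ) • (w - w') := by module
    rw [this, inner_sub_right, inner_smul_right, inner_smul_right, real_inner_self_eq_norm_sq]
  have h1 := real_inner_le_norm (x - y) (l • (x - (y - μ • w')) + μ • (x - l • w - y))
  have h2 : ‖l • (x - (y - μ • w')) + μ • (x - l • w - y)‖ ≤
      l * ‖x - (y - μ • w')‖ + μ * ‖x - l • w - y‖ := by
    refine (norm_add_le _ _).trans (le_of_eq ?_)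
    rw [norm_smul, norm_smul, Real.norm_of_nonneg hl.le, Real.norm_of_nonneg hμ.le]
  rcases (norm_nonneg (x - y)).eq_or_lt with h0 | h0
  · rw [← h0, mul_zero]; positivity
  · have h3 : 0 ≤ -(l * μ * inner ℝ (x - y) (w - w')) := by
      have : 0 ≤ l * μ := by positivity
      nlinarith
    have h4 := h1.trans (mul_le_mul_of_nonneg_left h2 h0.le)
    rw [e] at h4
    refine le_of_mul_le_mul_left ?_ h0
    nlinarith

lemma IsMDissipative.norm_resolventMap_sub_le (hC : IsMDissipative C) {α : ℝ} (hα : 0 < α)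
    (x y : E) : ‖resolventMap C α x - resolventMap C α y‖ ≤ ‖x - y‖ := by
  have h := hC.1 _ _ _ _ (hC.yosida_mem hα x) (hC.yosida_mem hα y)
  set a := resolventMap C α x
  set b := resolventMap C α y
  have e : x - y = (a - b) - α • (yosida C α x - yosida C α y) := by
    have e1 : a = _ := resolventMap_eq_add hα x
    have e2 : b = _ := resolventMap_eq_add hα y
    rw [e1, e2]; module
  have h1 := real_inner_le_norm (a - b) (x - y)
  nth_rewrite 1 [e] at h1
  rw [inner_sub_right, inner_smul_right, real_inner_self_eq_norm_sq] at h1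
  rcases (norm_nonneg (a - b)).eq_or_lt with h0 | h0
  · rw [← h0]; positivity
  · refine le_of_mul_le_mul_left ?_ h0
    nlinarith

lemma IsMDissipative.norm_iterate_sub_le (hC : IsMDissipative C) {α : ℝ} (hα : 0 < α) (n : ℕ)
    (x y : E) : ‖(resolventMap C α)^[n] x - (resolventMap C α)^[n] y‖ ≤ ‖x - y‖ := by
  induction n with
  | zero => simp
  | succ n ih =>
    rw [Function.iterate_succ_apply', Function.iterate_succ_apply']
    exact (hC.norm_resolventMap_sub_le hα _ _).trans ih

lemma IsMDissipative.continuous_resolventMap (hC : IsMDissipative C) {α : ℝ} (hα : 0 < α) :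
    Continuous (resolventMap C α) :=
  (LipschitzWith.of_dist_le_mul (K := 1) fun x y => by
    simpa [dist_eq_norm] using hC.norm_resolventMap_sub_le hα x y).continuous

lemma IsMDissipative.continuous_yosida (hC : IsMDissipative C) {α : ℝ} (hα : 0 < α) :
    Continuous (yosida C α) :=
  ((hC.continuous_resolventMap hα).sub continuous_id).const_smul _

lemma IsMDissipative.norm_yosida_le (hC : IsMDissipative C) {α : ℝ} (hα : 0 < α) {x w : E}
    (hx : (x, w) ∈ C) : ‖yosida C α x‖ ≤ ‖w‖ := by
  have h := hC.1 _ _ _ _ (hC.yosida_mem hα x) hx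
  rw [resolventMap_eq_add hα, add_sub_cancel_left, inner_smul_left, inner_sub_right,
    real_inner_self_eq_norm_sq] at h
  simp only [conj_trivial] at h
  have h1 := real_inner_le_norm (yosida C α x) w
  have h2 : ‖yosida C α x‖ ^ 2 - inner ℝ (yosida C α x) w ≤ 0 := by
    by_contra! hh
    nlinarith [mul_pos hα hh]
  rcases (norm_nonneg (yosida C α x)).eq_or_lt with h0 | h0
  · rw [← h0]; positivity
  · refine le_of_mul_le_mul_left ?_ h0
    nlinarith

lemma IsMDissipative.norm_iterate_sub_self_le (hC : IsMDissipative C) {α : ℝ} (hα : 0 < α)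
    {x z : E} (hx : (x, z) ∈ C) (n : ℕ) :
    ‖(resolventMap C α)^[n] x - x‖ ≤ n * α * ‖z‖ := by
  induction n with
  | zero => simp
  | succ n ih =>
    rw [Function.iterate_succ_apply]
    have h1 := hC.norm_iterate_sub_le hα n (resolventMap C α x) x
    have h2 : ‖resolventMap C α x - x‖ ≤ α * ‖z‖ := by
      rw [resolventMap_eq_add hα, add_sub_cancel_left, norm_smul, Real.norm_of_nonneg hα.le]
      exact mul_le_mul_of_nonneg_left (hC.norm_yosida_le hα hx) hα.le
    have h3 := norm_sub_le_norm_sub_add_norm_sub ((resolventMap C α)^[n] (resolventMap C α x))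
      ((resolventMap C α)^[n] x) x
    push_cast
    linarith

/-- **Kobayashi's estimate** for resolvent iterates with different step sizes. -/
lemma IsMDissipative.kobayashi (hC : IsMDissipative C) {x z : E} (hx : (x, z) ∈ C) {l μ : ℝ}
    (hl : 0 < l) (hμ : 0 < μ) (m n : ℕ) :
    ‖(resolventMap C l)^[m] x - (resolventMap C μ)^[n] x‖ ^ 2 ≤
      ‖z‖ ^ 2 * ((m * l - n * μ) ^ 2 + m * l ^ 2 + n * μ ^ 2) := by
  induction m generalizing n with
  | zero =>
    have h := hC.norm_iterate_sub_self_le hμ hx n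
    rw [Function.iterate_zero_apply, norm_sub_rev]
    have h2 := pow_le_pow_left₀ (norm_nonneg _) h 2
    have : 0 ≤ ‖z‖ ^ 2 * (n * μ ^ 2) := by positivity
    push_cast
    nlinarith
  | succ m ihm =>
    induction n with
    | zero =>
      have h := hC.norm_iterate_sub_self_le hl hx (m + 1)
      rw [Function.iterate_zero_apply]
      have h2 := pow_le_pow_left₀ (norm_nonneg _) h 2
      have : 0 ≤ ‖z‖ ^ 2 * ((m + 1 : ℕ) * l ^ 2) := by positivity
      push_cast at *
      nlinarith
    | succ n ihn =>
      have ihm' := ihm (n + 1)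
      rw [Function.iterate_succ_apply', Function.iterate_succ_apply'] at *
      set X := (resolventMap C l)^[m] x
      set Y := (resolventMap C μ)^[n] x
      have key := hC.1.add_mul_norm_sub_le hl hμ (hC.yosida_mem hl X) (hC.yosida_mem hμ Y)
      have e1 : resolventMap C l X - l • yosida C l X = X := by
        rw [resolventMap_eq_add hl]; abel
      have e2 : resolventMap C μ Y - μ • yosida C μ Y = Y := by
        rw [resolventMap_eq_add hμ]; abel
      rw [e1, e2] at key
      set A := ‖resolventMap C l X - Y‖
      set B := ‖X - resolventMap C μ Y‖
      set D := ‖resolventMap C l X - resolventMap C μ Y‖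
      have hs : 0 < l + μ := by positivity
      have hD : (l + μ) * D ^ 2 ≤ l * A ^ 2 + μ * B ^ 2 := by
        have h1 : ((l + μ) * D) ^ 2 ≤ (l * A + μ * B) ^ 2 :=
          pow_le_pow_left₀ (by positivity) key 2
        have h2 : (l * A + μ * B) ^ 2 ≤ (l + μ) * (l * A ^ 2 + μ * B ^ 2) := by
          nlinarith [mul_nonneg (mul_pos hl hμ).le (sq_nonneg (A - B))]
        refine le_of_mul_le_mul_left ?_ hs
        nlinarith
      refine le_of_mul_le_mul_left ?_ hs
      -- The claimed bound solves the averaged recursion with equality: with `q = (m+1)l - (n+1)μ`,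
      -- the cross terms of `l(q+μ)²` and `μ(q-l)²` cancel, and the remainder `lμ² + μl²` is what
      -- the two step-size sums lack.
      refine hD.trans ((add_le_add (mul_le_mul_of_nonneg_left ihn hl.le)
        (mul_le_mul_of_nonneg_left ihm' hμ.le)).trans (le_of_eq ?_))
      push_cast
      ring

end Resolvent

/-! ### The contraction semigroup generated by `C`. -/

section Semigroup

variable {E : Type*} [NormedAddCommGroup E] [InnerProductSpace ℝ E] {C : Set (E × E)}

/-- Kobayashi's estimate settles starting points in the domain; density and the contraction property
extend it to all `x`. The filter is arbitrary so that one statement yields both the Cauchy property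
(on a product filter) and the independence of the limit from the step sizes. -/
lemma IsMDissipative.tendsto_dist_iterate (hC : IsMDissipative C) (hdense : Dense (domain C))
    {ι : Type*} {f : Filter ι} {s s' : ι → ℝ} {k k' : ι → ℕ} {t : ℝ}
    (hs : ∀ᶠ i in f, 0 < s i) (hs' : ∀ᶠ i in f, 0 < s' i)
    (hs0 : Tendsto s f (𝓝 0)) (hs0' : Tendsto s' f (𝓝 0))
    (hk : Tendsto (fun i => k i * s i) f (𝓝 t)) (hk' : Tendsto (fun i => k' i * s' i) f (𝓝 t))
    (x : E) :
    Tendsto (fun i => dist ((resolventMap C (s i))^[k i] x) ((resolventMap C (s' i))^[k' i] x))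
      f (𝓝 0) := by
  rw [Metric.tendsto_nhds]
  intro ε hε
  obtain ⟨y, ⟨z, hyz⟩, hxy⟩ := hdense.exists_dist_lt x (show 0 < ε / 4 by positivity)
  have hlim : Tendsto (fun i => ‖z‖ ^ 2 * ((k i * s i - k' i * s' i) ^ 2 + (k i * s i) * s i +
      (k' i * s' i) * s' i)) f (𝓝 0) := by
    have := (((((hk.sub hk').pow 2).add (hk.mul hs0)).add (hk'.mul hs0')).const_mul (‖z‖ ^ 2))
    simpa using this
  have hε2 : (0 : ℝ) < (ε / 4) ^ 2 := by positivity
  filter_upwards [hs, hs', hlim.eventually (gt_mem_nhds hε2)] with i h1 h2 h3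
  have h4 := hC.kobayashi hyz h1 h2 (k i) (k' i)
  have h5 : ‖(resolventMap C (s i))^[k i] y - (resolventMap C (s' i))^[k' i] y‖ < ε / 4 := by
    refine lt_of_pow_lt_pow_left₀ 2 (by positivity) (h4.trans_lt (lt_of_eq_of_lt ?_ h3))
    ring
  have h6 := hC.norm_iterate_sub_le h1 (k i) x y
  have h7 := hC.norm_iterate_sub_le h2 (k' i) y x
  rw [dist_eq_norm] at hxy
  rw [norm_sub_rev y x] at h7
  rw [Real.dist_0_eq_abs, abs_of_nonneg dist_nonneg]
  have h8 := dist_triangle4 ((resolventMap C (s i))^[k i] x) ((resolventMap C (s i))^[k i] y)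
    ((resolventMap C (s' i))^[k' i] y) ((resolventMap C (s' i))^[k' i] x)
  simp only [dist_eq_norm] at h8 ⊢
  linarith

variable [CompleteSpace E]

lemma IsMDissipative.tendsto_iterate (hC : IsMDissipative C) (hdense : Dense (domain C))
    {s : ℕ → ℝ} {k : ℕ → ℕ} {t : ℝ} (ht : 0 ≤ t) (hs : ∀ᶠ i in atTop, 0 < s i)
    (hs0 : Tendsto s atTop (𝓝 0)) (hk : Tendsto (fun i => k i * s i) atTop (𝓝 t)) (x : E) :
    Tendsto (fun i => (resolventMap C (s i))^[k i] x) atTop (𝓝 (semigroup C t x)) := by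
  rcases ht.eq_or_lt with rfl | ht
  · rw [semigroup, if_pos le_rfl]
    have := hC.tendsto_dist_iterate hdense hs hs hs0 hs0 hk (k' := fun _ => 0) (by simp) x
    simp only [Function.iterate_zero_apply] at this
    exact tendsto_iff_dist_tendsto_zero.2 this
  · rw [semigroup, if_neg ht.not_ge]
    have p1 : ∀ᶠ n : ℕ in atTop, 0 < t / n := by
      filter_upwards [eventually_gt_atTop 0] with n hn
      positivity
    have p2 : Tendsto (fun n : ℕ => t / n) atTop (𝓝 0) := tendsto_const_div_atTop_nhds_zero_nat t
    have p3 : Tendsto (fun n : ℕ => (n : ℝ) * (t / n)) atTop (𝓝 t) := by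
      refine tendsto_const_nhds.congr' ?_
      filter_upwards [eventually_gt_atTop 0] with n hn
      field_simp
    have hcau : CauchySeq fun n : ℕ => (resolventMap C (t / n))^[n] x := by
      rw [cauchySeq_iff_tendsto_dist_atTop_0, ← prod_atTop_atTop_eq]
      exact hC.tendsto_dist_iterate hdense (p1.prod_inl _) (p1.prod_inr _) (p2.comp tendsto_fst) (p2.comp tendsto_snd)
        (p3.comp tendsto_fst) (p3.comp tendsto_snd) x
    have hlim := hcau.tendsto_limUnder
    exact hlim.congr_dist (hC.tendsto_dist_iterate hdense p1 hs p2 hs0 p3 hk x)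

lemma tendsto_floor_mul_inv {t : ℝ} (ht : 0 ≤ t) :
    Tendsto (fun n : ℕ => (⌊t * (n + 1)⌋₊ : ℝ) * (1 / ((n : ℝ) + 1))) atTop (𝓝 t) := by
  have h0 : Tendsto (fun n : ℕ => 1 / ((n : ℝ) + 1)) atTop (𝓝 0) :=
    tendsto_one_div_add_atTop_nhds_zero_nat
  have h1 : Tendsto (fun n : ℕ => t - 1 / ((n : ℝ) + 1)) atTop (𝓝 t) := by
    simpa using tendsto_const_nhds.sub h0
  refine tendsto_of_tendsto_of_tendsto_of_le_of_le h1 tendsto_const_nhds ?_ ?_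
  · intro n
    have hn : (0 : ℝ) < n + 1 := by positivity
    have := Nat.lt_floor_add_one (t * ((n : ℝ) + 1))
    simp only
    rw [mul_one_div, le_div_iff₀ hn, sub_mul, one_div, inv_mul_cancel₀ hn.ne']
    linarith
  · intro n
    have hn : (0 : ℝ) < n + 1 := by positivity
    have := Nat.floor_le (show 0 ≤ t * ((n : ℝ) + 1) by positivity)
    simp only
    rwa [mul_one_div, div_le_iff₀ hn]

/-- The step size here does not depend on `t`, so iterates for different times can be composed and
compared directly; the semigroup law and continuity in time rely on this. -/
lemma IsMDissipative.tendsto_iterate_floor (hC : IsMDissipative C) (hdense : Dense (domain C))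
    {t : ℝ} (ht : 0 ≤ t) (x : E) :
    Tendsto (fun n : ℕ => (resolventMap C (1 / ((n : ℝ) + 1)))^[⌊t * (n + 1)⌋₊] x) atTop
      (𝓝 (semigroup C t x)) :=
  hC.tendsto_iterate hdense ht (Eventually.of_forall fun n => by positivity)
    tendsto_one_div_add_atTop_nhds_zero_nat (tendsto_floor_mul_inv ht) x

lemma IsMDissipative.norm_semigroup_sub_le (hC : IsMDissipative C) (hdense : Dense (domain C))
    {t : ℝ} (ht : 0 ≤ t) (x y : E) : ‖semigroup C t x - semigroup C t y‖ ≤ ‖x - y‖ :=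
  le_of_tendsto ((hC.tendsto_iterate_floor hdense ht x).sub
    (hC.tendsto_iterate_floor hdense ht y)).norm
    (Eventually.of_forall fun n => hC.norm_iterate_sub_le (by positivity) _ x y)

omit [CompleteSpace E] in
lemma semigroup_zero (x : E) : semigroup C 0 x = x := by simp [semigroup]

lemma IsMDissipative.semigroup_add (hC : IsMDissipative C) (hdense : Dense (domain C))
    {s t : ℝ} (hs : 0 ≤ s) (ht : 0 ≤ t) (x : E) :
    semigroup C (s + t) x = semigroup C s (semigroup C t x) := by
  have h1 : Tendsto (fun n : ℕ => (resolventMap C (1 / ((n : ℝ) + 1)))^[⌊s * (n + 1)⌋₊ +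
      ⌊t * (n + 1)⌋₊] x) atTop (𝓝 (semigroup C (s + t) x)) := by
    refine hC.tendsto_iterate hdense (add_nonneg hs ht)
      (Eventually.of_forall fun n => by positivity) tendsto_one_div_add_atTop_nhds_zero_nat ?_ x
    refine ((tendsto_floor_mul_inv hs).add (tendsto_floor_mul_inv ht)).congr fun n => ?_
    push_cast
    ring
  have h2 := hC.tendsto_iterate_floor hdense hs (semigroup C t x)
  refine tendsto_nhds_unique h1 (h2.congr_dist ?_)
  have h3 := tendsto_iff_dist_tendsto_zero.1 (hC.tendsto_iterate_floor hdense ht x)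
  refine squeeze_zero (fun _ => dist_nonneg) (fun n => ?_) h3
  rw [Function.iterate_add_apply, dist_comm, dist_eq_norm, dist_eq_norm]
  exact hC.norm_iterate_sub_le (by positivity) _ _ _

lemma IsMDissipative.continuousOn_semigroup (hC : IsMDissipative C) (hdense : Dense (domain C))
    (x : E) : ContinuousOn (fun t => semigroup C t x) (Ici 0) := by
  have key : ∀ y z : E, (y, z) ∈ C → ∀ s t : ℝ, 0 ≤ s → 0 ≤ t →
      ‖semigroup C s y - semigroup C t y‖ ≤ ‖z‖ * |s - t| := by
    intro y z hyz s t hs ht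
    have h0 : Tendsto (fun n : ℕ => 1 / ((n : ℝ) + 1)) atTop (𝓝 0) :=
      tendsto_one_div_add_atTop_nhds_zero_nat
    have h1 := tendsto_floor_mul_inv hs
    have h2 := tendsto_floor_mul_inv ht
    have h3 := ((((h1.sub h2).pow 2).add (h1.mul h0)).add (h2.mul h0)).const_mul (‖z‖ ^ 2)
    have h4 := ((hC.tendsto_iterate_floor hdense hs y).sub
      (hC.tendsto_iterate_floor hdense ht y)).norm.pow 2
    have h5 := le_of_tendsto_of_tendsto' h4 h3 fun n => by
      refine (hC.kobayashi hyz (by positivity) (by positivity) _ _).trans (le_of_eq ?_)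
      ring
    refine le_of_sq_le_sq ?_ (by positivity)
    rw [mul_pow, sq_abs]
    simpa using h5
  rw [Metric.continuousOn_iff]
  intro t ht ε hε
  obtain ⟨y, ⟨z, hyz⟩, hxy⟩ := hdense.exists_dist_lt x (show 0 < ε / 4 by positivity)
  refine ⟨ε / (4 * (‖z‖ + 1)), by positivity, fun s hs hst => ?_⟩
  have h1 := hC.norm_semigroup_sub_le hdense hs x y
  have h2 := hC.norm_semigroup_sub_le hdense ht y x
  have h3 := key y z hyz s t hs ht
  have h4 : ‖z‖ * |s - t| ≤ ε / 4 := by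
    rw [Real.dist_eq] at hst
    have : (‖z‖ + 1) * |s - t| ≤ ε / 4 := by
      rw [lt_div_iff₀ (by positivity)] at hst
      linarith
    nlinarith [abs_nonneg (s - t)]
  have h5 := dist_triangle4 (semigroup C s x) (semigroup C s y) (semigroup C t y)
    (semigroup C t x)
  rw [norm_sub_rev y x] at h2
  simp only [dist_eq_norm] at *
  linarith

end Semigroup

/-! ### Convergence of Yosida approximations to the canonical restriction. -/

section Canonical

variable {E : Type*} [NormedAddCommGroup E] [InnerProductSpace ℝ E] [CompleteSpace E]
  {C : Set (E × E)}

-- Dissipativity at the two resolvents reads `h‖A‖² + k‖B‖² ≤ (h + k)⟨A, B⟩`. It forces `‖B‖ ≤ ‖A‖`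
-- and then `‖B‖² ≤ ⟨A, B⟩`. Monotonicity of the norms together with this bound makes bounded Yosida
-- approximations Cauchy.
omit [CompleteSpace E] in
lemma IsMDissipative.norm_yosida_sub_sq_le (hC : IsMDissipative C) {h k : ℝ} (hh : 0 < h)
    (hk : h ≤ k) (x : E) :
    ‖yosida C h x - yosida C k x‖ ^ 2 ≤ ‖yosida C h x‖ ^ 2 - ‖yosida C k x‖ ^ 2 := by
  have hk0 : 0 < k := hh.trans_le hk
  have h1 := hC.1 _ _ _ _ (hC.yosida_mem hh x) (hC.yosida_mem hk0 x)
  rw [resolventMap_eq_add hh, resolventMap_eq_add hk0, add_sub_add_left_eq_sub] at h1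
  set A := yosida C h x
  set B := yosida C k x
  have h2 : h * ‖A‖ ^ 2 + k * ‖B‖ ^ 2 ≤ (h + k) * inner ℝ A B := by
    have : inner ℝ (h • A - k • B) (A - B) =
        h * ‖A‖ ^ 2 + k * ‖B‖ ^ 2 - (h + k) * inner ℝ A B := by
      simp only [inner_sub_left, inner_sub_right, inner_smul_left, conj_trivial,
        real_inner_self_eq_norm_sq, real_inner_comm A B]
      ring
    linarith
  have h3 := real_inner_le_norm A B
  have h4 : ‖B‖ ≤ ‖A‖ := by
    by_contra! hlt
    have h5 : (‖A‖ - ‖B‖) * (h * ‖A‖ - k * ‖B‖) ≤ 0 := by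
      nlinarith [mul_le_mul_of_nonneg_left h3 (add_pos hh hk0).le]
    have h6 : h * ‖A‖ - k * ‖B‖ < 0 := by
      nlinarith [mul_le_mul_of_nonneg_right hk (norm_nonneg A), mul_lt_mul_of_pos_left hlt hk0]
    nlinarith [mul_pos_of_neg_of_neg (sub_neg.2 hlt) h6]
  have h5 : ‖B‖ ^ 2 ≤ ‖A‖ ^ 2 := pow_le_pow_left₀ (norm_nonneg _) h4 2
  rw [norm_sub_sq_real]
  have h6 : (h + k) * (2 * ‖B‖ ^ 2 - 2 * inner ℝ A B) ≤ 0 := by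
    nlinarith [mul_le_mul_of_nonneg_left h5 hh.le]
  have h7 : 2 * ‖B‖ ^ 2 - 2 * inner ℝ A B ≤ 0 := by
    by_contra! h8
    nlinarith [mul_pos (add_pos hh hk0) h8]
  linarith

omit [CompleteSpace E] in
/-- The graph of an `m`-dissipative operator is closed. -/
lemma IsMDissipative.mem_of_tendsto (hC : IsMDissipative C) {ι : Type*} {f : Filter ι} [f.NeBot]
    {u w : ι → E} {x z : E} (hu : Tendsto u f (𝓝 x)) (hw : Tendsto w f (𝓝 z))
    (huw : ∀ i, (u i, w i) ∈ C) : (x, z) ∈ C := by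
  -- Maximality: a graph point with `x' - z' = x - z` is compared with the sequence; the limit
  -- inequality becomes `‖x - x'‖² ≤ 0`.
  obtain ⟨x', z', hC', hxz⟩ := hC.2 1 one_pos (x - z)
  have h1 : inner ℝ (x - x') (z - z') ≤ 0 :=
    le_of_tendsto ((hu.sub_const x').inner (hw.sub_const z'))
      (Eventually.of_forall fun i => hC.1 _ _ _ _ (huw i) hC')
  rw [one_smul] at hxz
  have h2 : z - z' = x - x' := by
    rw [sub_eq_iff_eq_add] at hxz ⊢
    rw [hxz]; abel
  rw [h2, real_inner_self_nonpos] at h1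
  rw [h1] at h2
  rwa [sub_eq_zero.1 h1, sub_eq_zero.1 h2]

/-- Where the Yosida approximations stay bounded they converge to the canonical restriction. -/
lemma IsMDissipative.exists_canonical (hC : IsMDissipative C) {x : E} {r : ℝ}
    (hb : ∀ h, 0 < h → ‖yosida C h x‖ ≤ r) :
    ∃ ζ, (x, ζ) ∈ canonicalRestriction C ∧ ‖ζ‖ ≤ r ∧
      Tendsto (fun n : ℕ => yosida C (1 / ((n : ℝ) + 1)) x) atTop (𝓝 ζ) := by
  have hpos : ∀ n : ℕ, 0 < 1 / ((n : ℝ) + 1) := fun n => by positivity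
  have hsq : ∀ n m : ℕ, n ≤ m →
      ‖yosida C (1 / ((m : ℝ) + 1)) x - yosida C (1 / ((n : ℝ) + 1)) x‖ ^ 2 ≤
      ‖yosida C (1 / ((m : ℝ) + 1)) x‖ ^ 2 - ‖yosida C (1 / ((n : ℝ) + 1)) x‖ ^ 2 := by
    intro n m hnm
    exact hC.norm_yosida_sub_sq_le (hpos m) (one_div_le_one_div_of_le (by positivity)
      (by exact_mod_cast Nat.succ_le_succ hnm)) x
  set u : ℕ → E := fun n => yosida C (1 / ((n : ℝ) + 1)) x with hu
  have hmono : Monotone fun n => ‖u n‖ ^ 2 := fun n m hnm => by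
    have := hsq n m hnm
    have := sq_nonneg ‖u m - u n‖
    simp only [hu] at *
    linarith
  have hbd : BddAbove (range fun n => ‖u n‖ ^ 2) :=
    ⟨r ^ 2, by rintro _ ⟨n, rfl⟩; exact pow_le_pow_left₀ (norm_nonneg _) (hb _ (hpos n)) 2⟩
  have hcau : CauchySeq u := by
    rw [Metric.cauchySeq_iff']
    intro ε hε
    have hlim := tendsto_atTop_ciSup hmono hbd
    obtain ⟨N, hN⟩ := (hlim.eventually (lt_mem_nhds
      (sub_lt_self (⨆ n, ‖u n‖ ^ 2) (show 0 < ε ^ 2 by positivity)))).exists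
    refine ⟨N, fun n hn => ?_⟩
    rw [dist_eq_norm]
    refine lt_of_pow_lt_pow_left₀ 2 hε.le ((hsq N n hn).trans_lt ?_)
    have := le_ciSup hbd n
    simp only [hu] at *
    linarith
  obtain ⟨ζ, hζ⟩ := cauchySeq_tendsto_of_complete hcau
  have h0 : Tendsto (fun n : ℕ => 1 / ((n : ℝ) + 1)) atTop (𝓝 0) :=
    tendsto_one_div_add_atTop_nhds_zero_nat
  have hJ : Tendsto (fun n : ℕ => resolventMap C (1 / ((n : ℝ) + 1)) x) atTop (𝓝 x) := by
    have := (h0.smul hζ).const_add x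
    rw [zero_smul, add_zero] at this
    exact this.congr fun n => (resolventMap_eq_add (hpos n) x).symm
  refine ⟨ζ, ⟨hC.mem_of_tendsto hJ hζ fun n => hC.yosida_mem (hpos n) x, fun w hw => ?_⟩, ?_, hζ⟩
  · exact le_of_tendsto hζ.norm (Eventually.of_forall fun n => hC.norm_yosida_le (hpos n) hw)
  · exact le_of_tendsto hζ.norm (Eventually.of_forall fun n => hb _ (hpos n))

end Canonical

/-! ### Triangle inequality and compactness for the Tataru distance. -/

section TataruDistance

variable {E : Type*} [NormedAddCommGroup E] [InnerProductSpace ℝ E] {C : Set (E × E)}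

lemma bddBelow_range_tataruDist (C : Set (E × E)) (x y : E) :
    BddBelow (range fun t : ℝ≥0 => (t : ℝ) + ‖x - semigroup C t y‖) :=
  ⟨0, by rintro _ ⟨t, rfl⟩; positivity⟩

lemma tataruDist_nonneg (C : Set (E × E)) (x y : E) : 0 ≤ tataruDist C x y :=
  le_ciInf fun t => by positivity

lemma tataruDist_le (C : Set (E × E)) (x y : E) {t : ℝ} (ht : 0 ≤ t) :
    tataruDist C x y ≤ t + ‖x - semigroup C t y‖ :=
  ciInf_le (bddBelow_range_tataruDist C x y) ⟨t, ht⟩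

lemma exists_lt_of_tataruDist_lt {x y : E} {r : ℝ} (h : tataruDist C x y < r) :
    ∃ t : ℝ, 0 ≤ t ∧ t + ‖x - semigroup C t y‖ < r := by
  obtain ⟨t, ht⟩ := exists_lt_of_ciInf_lt h
  exact ⟨t, t.2, ht⟩

lemma tataruDist_le_norm (C : Set (E × E)) (x y : E) : tataruDist C x y ≤ ‖x - y‖ := by
  simpa [semigroup_zero] using tataruDist_le C x y le_rfl

lemma tataruDist_self (C : Set (E × E)) (x : E) : tataruDist C x x = 0 :=
  le_antisymm (by simpa using tataruDist_le_norm C x x) (tataruDist_nonneg C x x)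

lemma tataruDist_le_add_norm (C : Set (E × E)) (x x' y : E) :
    tataruDist C x y ≤ tataruDist C x' y + ‖x - x'‖ := by
  refine le_of_forall_pos_lt_add fun ε hε => ?_
  obtain ⟨t, ht, h⟩ := exists_lt_of_tataruDist_lt (lt_add_of_pos_right (tataruDist C x' y) hε)
  have h1 := tataruDist_le C x y ht
  have h2 := norm_sub_le_norm_sub_add_norm_sub x x' (semigroup C t y)
  linarith

lemma continuous_tataruDist (C : Set (E × E)) (y : E) : Continuous fun x => tataruDist C x y := by
  refine (LipschitzWith.of_le_add_mul 1 fun x x' => ?_).continuous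
  simpa [dist_eq_norm] using tataruDist_le_add_norm C x x' y

variable [CompleteSpace E]

/-- Near-optimal times `t` and `s` add up by the semigroup law, and `S(t)` does not increase the
error made in reaching `y` from `z`. -/
lemma IsMDissipative.tataruDist_triangle (hC : IsMDissipative C) (hdense : Dense (domain C))
    (x y z : E) : tataruDist C x z ≤ tataruDist C x y + tataruDist C y z := by
  refine le_of_forall_pos_lt_add fun ε hε => ?_
  obtain ⟨t, ht, h1⟩ := exists_lt_of_tataruDist_lt
    (lt_add_of_pos_right (tataruDist C x y) (half_pos hε))
  obtain ⟨s, hs, h2⟩ := exists_lt_of_tataruDist_lt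
    (lt_add_of_pos_right (tataruDist C y z) (half_pos hε))
  have h3 := tataruDist_le C x z (add_nonneg ht hs)
  rw [hC.semigroup_add hdense ht hs] at h3
  have h4 := norm_sub_le_norm_sub_add_norm_sub x (semigroup C t y)
    (semigroup C t (semigroup C s z))
  have h5 := hC.norm_semigroup_sub_le hdense ht y (semigroup C s z)
  linarith

/-- A sequence that is forward Cauchy for the Tataru distance is relatively compact. -/
lemma IsMDissipative.exists_compact_of_tataruDist (hC : IsMDissipative C)
    (hdense : Dense (domain C)) {w : ℕ → E}
    (hw : ∀ η, 0 < η → ∃ n, ∀ m, n ≤ m → tataruDist C (w m) (w n) ≤ η) :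
    ∃ K, IsCompact K ∧ ∀ n, w n ∈ K := by
  refine ⟨closure (range w), TotallyBounded.isCompact_of_isClosed ?_ isClosed_closure,
    fun n => subset_closure (mem_range_self n)⟩
  refine TotallyBounded.closure (Metric.totallyBounded_iff.2 fun ε hε => ?_)
  obtain ⟨n, hn⟩ := hw (ε / 4) (by positivity)
  -- All later terms are within `ε / 2` of this short orbit, so a finite net of the orbit covers the
  -- tail.
  have hK : IsCompact ((fun t => semigroup C t (w n)) '' Icc 0 (ε / 2)) :=
    isCompact_Icc.image_of_continuousOn
      ((hC.continuousOn_semigroup hdense (w n)).mono Icc_subset_Ici_self)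
  obtain ⟨T, hT, hcov⟩ := Metric.totallyBounded_iff.1 hK.totallyBounded (ε / 2) (by positivity)
  refine ⟨T ∪ w '' Iio n, hT.union ((finite_Iio n).image w), ?_⟩
  rintro _ ⟨m, rfl⟩
  rw [mem_iUnion₂]
  rcases lt_or_ge m n with hm | hm
  · exact ⟨w m, Or.inr ⟨m, hm, rfl⟩, Metric.mem_ball_self hε⟩
  · obtain ⟨t, ht, h1⟩ := exists_lt_of_tataruDist_lt
      ((hn m hm).trans_lt (show ε / 4 < ε / 2 by linarith))
    have h2 := norm_nonneg (w m - semigroup C t (w n))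
    obtain ⟨y, hy, hy'⟩ := mem_iUnion₂.1 (hcov ⟨t, ⟨ht, by linarith⟩, rfl⟩)
    refine ⟨y, Or.inl hy, ?_⟩
    rw [Metric.mem_ball] at hy' ⊢
    have h3 := dist_triangle (w m) (semigroup C t (w n)) y
    rw [dist_eq_norm (w m) (semigroup C t (w n))] at h3
    linarith

end TataruDistance

/-! ### Ekeland's principle for a nonsymmetric distance. -/

section Ekeland

/-- **Ekeland's variational principle** for a quasi-distance `d` on a topological space whose
forward Cauchy sequences have cluster points. -/
theorem exists_perturbed_max {X : Type*} [TopologicalSpace X] {d : X → X → ℝ}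
    (hd : ∀ x y, 0 ≤ d x y) (hd0 : ∀ x, d x x = 0) (htri : ∀ x y z, d x z ≤ d x y + d y z)
    (hdc : ∀ y, Continuous fun x => d x y)
    (hcomp : ∀ w : ℕ → X, (∀ η, 0 < η → ∃ n, ∀ m, n ≤ m → d (w m) (w n) ≤ η) →
      ∃ (z : X) (σ : ℕ → ℕ), StrictMono σ ∧ Tendsto (w ∘ σ) atTop (𝓝 z))
    {A : Set X} {F : X → ℝ} (hF : ∀ c, IsClosed {x | x ∈ A ∧ c ≤ F x}) (hbdd : BddAbove (F '' A))
    {ρ : ℝ} (hρ : 0 < ρ) {x₀ : X} (hx₀ : x₀ ∈ A) :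
    ∃ z ∈ A, F x₀ ≤ F z ∧ ∀ x ∈ A, F x - ρ * d x z ≤ F z := by
  -- Points preferable to `y` even after paying the distance. The relation is transitive by the
  -- triangle inequality; the sequence moves to a point of `S` whose value is within `2⁻ⁿ` of the
  -- best one.
  let S : X → Set X := fun y => {x | x ∈ A ∧ F y + ρ * d x y ≤ F x}
  have hself : ∀ y ∈ A, y ∈ S y := fun y hy => ⟨hy, by simp [hd0]⟩
  have hbS : ∀ y, BddAbove (F '' S y) := fun y => hbdd.mono (image_mono fun x hx => hx.1)
  have hstep : ∀ (n : ℕ) (y : A), ∃ x : A, (x : X) ∈ S y ∧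
      ∀ x' ∈ S y, F x' ≤ F x + (1 / 2) ^ n := by
    rintro n ⟨y, hy⟩
    obtain ⟨_, ⟨x, hx, rfl⟩, hlt⟩ := exists_lt_of_lt_csSup (Set.Nonempty.image F ⟨y, hself y hy⟩)
      (sub_lt_self (sSup (F '' S y)) (show (0 : ℝ) < (1 / 2) ^ n by positivity))
    refine ⟨⟨x, hx.1⟩, hx, fun x' hx' => ?_⟩
    have := le_csSup (hbS y) (mem_image_of_mem F hx')
    simp only
    linarith
  choose next hnext hsup using hstep
  let w : ℕ → A := fun n => Nat.rec ⟨x₀, hx₀⟩ (fun n y => next n y) n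
  have hw1 : ∀ n, (w (n + 1)).1 ∈ S (w n).1 := fun n => hnext n (w n)
  have hw2 : ∀ n, ∀ x' ∈ S (w n).1, F x' ≤ F (w (n + 1)).1 + (1 / 2) ^ n := fun n => hsup n (w n)
  have htrans : ∀ x y z, x ∈ S y → y ∈ S z → x ∈ S z := fun x y z hx hy => by
    refine ⟨hx.1, ?_⟩
    have := hx.2
    have := hy.2
    have := mul_le_mul_of_nonneg_left (htri x y z) hρ.le
    linarith
  have hnest : ∀ n m, n ≤ m → (w m).1 ∈ S (w n).1 := by
    intro n m hnm
    induction m, hnm using Nat.le_induction with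
    | base => exact hself _ (w n).2
    | succ m _ ih => exact htrans _ _ _ (hw1 m) ih
  have hmono : Monotone fun n => F (w n).1 := fun n m hnm => by
    have := (hnest n m hnm).2
    have := mul_nonneg hρ.le (hd (w m).1 (w n).1)
    simp only
    linarith
  have hsmall : ∀ n x, x ∈ S (w (n + 1)).1 → ρ * d x (w (n + 1)).1 ≤ (1 / 2) ^ n := fun n x hx => by
    have := hx.2
    have := hw2 n x (htrans _ _ _ hx (hw1 n))
    linarith
  obtain ⟨z, σ, hσ, hz⟩ := hcomp (fun n => (w n).1) fun η hη => by
    obtain ⟨n, hn⟩ := exists_pow_lt_of_lt_one (mul_pos hρ hη) (show (1 / 2 : ℝ) < 1 by norm_num)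
    refine ⟨n + 1, fun m hm => ?_⟩
    have := hsmall n _ (hnest _ m hm)
    exact le_of_mul_le_mul_left (this.trans hn.le) hρ
  have hzmem : ∀ n, z ∈ A ∧ F (w n).1 ≤ F z := fun n => by
    refine (hF (F (w n).1)).mem_of_tendsto hz ?_
    filter_upwards [eventually_ge_atTop n] with k hk
    exact ⟨(w (σ k)).2, hmono (hk.trans (hσ.id_le k))⟩
  have hzS : ∀ n, z ∈ S (w n).1 := fun n => by
    refine ⟨(hzmem n).1, ?_⟩
    have hlim : Tendsto (fun k => F (w n).1 + ρ * d (w (σ k)).1 (w n).1) atTop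
        (𝓝 (F (w n).1 + ρ * d z (w n).1)) :=
      ((((hdc (w n).1).tendsto z).comp hz).const_mul ρ).const_add _
    refine le_of_tendsto hlim ?_
    filter_upwards [eventually_ge_atTop n] with k hk
    exact (hnest n (σ k) (hk.trans (hσ.id_le k))).2.trans (hzmem (σ k)).2
  refine ⟨z, (hzmem 0).1, (hzmem 0).2, fun x hx => ?_⟩
  -- A violating `x` would lie in `S z`, hence in every `S (w n)`, so its value could not exceed `F
  -- z`.
  by_contra! hlt
  have hxS : x ∈ S z := ⟨hx, by linarith⟩
  have h1 : F x ≤ F z := by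
    refine le_of_forall_pos_lt_add fun η hη => ?_
    obtain ⟨n, hn⟩ := exists_pow_lt_of_lt_one hη (show (1 / 2 : ℝ) < 1 by norm_num)
    have := hw2 n x (htrans _ _ _ hxS (hzS n))
    have := (hzmem (n + 1)).2
    linarith
  have := mul_nonneg hρ.le (hd x z)
  linarith

variable {E : Type*} [NormedAddCommGroup E] [InnerProductSpace ℝ E] [CompleteSpace E]
  {C : Set (E × E)}

/-- Ekeland's principle on `E × E × E` for the sum of the Tataru distances. -/
lemma IsMDissipative.exists_perturbed_max_prod (hC : IsMDissipative C) (hdense : Dense (domain C))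
    {A : Set (E × E × E)} {F : E × E × E → ℝ} (hF : ∀ c, IsClosed {x | x ∈ A ∧ c ≤ F x})
    (hbdd : BddAbove (F '' A)) {ρ : ℝ} (hρ : 0 < ρ) {x₀ : E × E × E} (hx₀ : x₀ ∈ A) :
    ∃ z ∈ A, F x₀ ≤ F z ∧ ∀ x ∈ A, F x - ρ * (tataruDist C x.1 z.1 +
      tataruDist C x.2.1 z.2.1 + tataruDist C x.2.2 z.2.2) ≤ F z := by
  let d : E × E × E → E × E × E → ℝ := fun x z => tataruDist C x.1 z.1 +
    tataruDist C x.2.1 z.2.1 + tataruDist C x.2.2 z.2.2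
  suffices h : (∀ x y, 0 ≤ d x y) ∧ (∀ x, d x x = 0) ∧ (∀ x y z, d x z ≤ d x y + d y z) ∧
      (∀ y, Continuous fun x => d x y) ∧
      ∀ w : ℕ → E × E × E, (∀ η, 0 < η → ∃ n, ∀ m, n ≤ m → d (w m) (w n) ≤ η) →
        ∃ (z : E × E × E) (σ : ℕ → ℕ), StrictMono σ ∧ Tendsto (w ∘ σ) atTop (𝓝 z) by
    obtain ⟨h1, h2, h3, h4, h5⟩ := h
    exact exists_perturbed_max h1 h2 h3 h4 h5 hF hbdd hρ hx₀
  simp only [d]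
  refine ⟨?_, ?_, ?_, ?_, ?_⟩
  · intro x y
    have := tataruDist_nonneg C x.1 y.1
    have := tataruDist_nonneg C x.2.1 y.2.1
    have := tataruDist_nonneg C x.2.2 y.2.2
    positivity
  · intro x
    simp [tataruDist_self]
  · intro x y z
    have := hC.tataruDist_triangle hdense x.1 y.1 z.1
    have := hC.tataruDist_triangle hdense x.2.1 y.2.1 z.2.1
    have := hC.tataruDist_triangle hdense x.2.2 y.2.2 z.2.2
    linarith
  · intro y
    exact (((continuous_tataruDist C y.1).comp continuous_fst).add
      ((continuous_tataruDist C y.2.1).comp (continuous_fst.comp continuous_snd))).add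
      ((continuous_tataruDist C y.2.2).comp (continuous_snd.comp continuous_snd))
  · intro w hw
    have hcl : ∀ π : E × E × E → E, (∀ m n, tataruDist C (π (w m)) (π (w n)) ≤
        tataruDist C (w m).1 (w n).1 + tataruDist C (w m).2.1 (w n).2.1 +
          tataruDist C (w m).2.2 (w n).2.2) → ∃ K, IsCompact K ∧ ∀ n, π (w n) ∈ K := by
      intro π hπ
      refine hC.exists_compact_of_tataruDist hdense (w := fun n => π (w n)) fun η hη => ?_
      obtain ⟨n, hn⟩ := hw η hη
      exact ⟨n, fun m hm => (hπ m n).trans (hn m hm)⟩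
    have h1 := fun m n => tataruDist_nonneg C (w m).1 (w n).1
    have h2 := fun m n => tataruDist_nonneg C (w m).2.1 (w n).2.1
    have h3 := fun m n => tataruDist_nonneg C (w m).2.2 (w n).2.2
    obtain ⟨K₁, hK₁, hm₁⟩ := hcl (fun x => x.1) fun m n => by
      linarith [h1 m n, h2 m n, h3 m n]
    obtain ⟨K₂, hK₂, hm₂⟩ := hcl (fun x => x.2.1) fun m n => by
      linarith [h1 m n, h2 m n, h3 m n]
    obtain ⟨K₃, hK₃, hm₃⟩ := hcl (fun x => x.2.2) fun m n => by
      linarith [h1 m n, h2 m n, h3 m n]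
    obtain ⟨z, -, σ, hσ, hz⟩ := (hK₁.prod (hK₂.prod hK₃)).tendsto_subseq
      fun n => ⟨hm₁ n, hm₂ n, hm₃ n⟩
    exact ⟨z, σ, hσ, hz⟩

end Ekeland

/-! ### Uniform first-order expansions of `φ(‖x‖²)` on bounded sets. -/

section Calculus

variable {E : Type*} [NormedAddCommGroup E] [InnerProductSpace ℝ E] {φ : ℝ → ℝ}

lemma continuousOn_derivWithin_Ici (hφ : ContDiffOn ℝ 1 φ (Ici 0)) :
    ContinuousOn (derivWithin φ (Ici 0)) (Ici 0) :=
  hφ.continuousOn_derivWithin (uniqueDiffOn_Ici 0) le_rfl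

lemma exists_pos_abs_derivWithin_sub_le (hφ : ContDiffOn ℝ 1 φ (Ici 0)) (T : ℝ) {m : ℝ}
    (hm : 0 < m) : ∃ r, 0 < r ∧ ∀ s t, s ∈ Icc 0 T → t ∈ Icc 0 T → |t - s| ≤ r →
      |derivWithin φ (Ici 0) t - derivWithin φ (Ici 0) s| ≤ m := by
  have h := isCompact_Icc.uniformContinuousOn_of_continuous
    ((continuousOn_derivWithin_Ici hφ).mono (Icc_subset_Ici_self : Icc 0 T ⊆ Ici 0))
  obtain ⟨r, hr, h⟩ := Metric.uniformContinuousOn_iff.1 h m hm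
  refine ⟨r / 2, half_pos hr, fun s t hs ht hst => ?_⟩
  have := h t ht s hs (by rw [Real.dist_eq]; linarith)
  rw [Real.dist_eq] at this
  exact this.le

lemma exists_abs_derivWithin_le (hφ : ContDiffOn ℝ 1 φ (Ici 0)) (T : ℝ) :
    ∃ B, 0 < B ∧ ∀ s ∈ Icc 0 T, |derivWithin φ (Ici 0) s| ≤ B := by
  obtain ⟨B, hB⟩ := isCompact_Icc.exists_bound_of_continuousOn
    ((continuousOn_derivWithin_Ici hφ).mono (Icc_subset_Ici_self : Icc 0 T ⊆ Ici 0))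
  exact ⟨max B 1, by positivity, fun s hs => (hB s hs).trans (le_max_left _ _)⟩

lemma exists_pos_abs_taylor_le (hφ : ContDiffOn ℝ 1 φ (Ici 0)) (T : ℝ) {m : ℝ}
    (hm : 0 < m) : ∃ r, 0 < r ∧ ∀ s t, s ∈ Icc 0 T → t ∈ Icc 0 T → |t - s| ≤ r →
      |φ t - φ s - derivWithin φ (Ici 0) s * (t - s)| ≤ m * |t - s| := by
  obtain ⟨r, hr, h⟩ := exists_pos_abs_derivWithin_sub_le hφ T hm
  refine ⟨r, hr, fun s t hs ht hst => ?_⟩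
  have hsub : uIcc s t ⊆ Icc 0 T := uIcc_subset_Icc hs ht
  have hd : ∀ x ∈ uIcc s t, HasDerivWithinAt (fun x => φ x - derivWithin φ (Ici 0) s * x)
      (derivWithin φ (Ici 0) x - derivWithin φ (Ici 0) s) (uIcc s t) x := by
    intro x hx
    have h1 := ((hφ.differentiableOn one_ne_zero) x (hsub hx).1).hasDerivWithinAt.mono
      (hsub.trans Icc_subset_Ici_self)
    simpa using! h1.sub ((hasDerivWithinAt_id x _).const_mul (derivWithin φ (Ici 0) s))
  have hb : ∀ x ∈ uIcc s t, ‖derivWithin φ (Ici 0) x - derivWithin φ (Ici 0) s‖ ≤ m := by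
    intro x hx
    refine h s x hs (hsub hx) ((?_ : |x - s| ≤ |t - s|).trans hst)
    exact abs_sub_left_of_mem_uIcc hx
  have := (convex_uIcc s t).norm_image_sub_le_of_norm_hasDerivWithin_le hd hb
    left_mem_uIcc right_mem_uIcc
  rw [Real.norm_eq_abs, Real.norm_eq_abs] at this
  convert this using 2
  ring

omit [InnerProductSpace ℝ E] in
lemma abs_norm_sq_sub_norm_sq_le {R : ℝ} {x y : E} (hx : ‖x‖ ≤ R) (hy : ‖y‖ ≤ R) :
    |‖x‖ ^ 2 - ‖y‖ ^ 2| ≤ 2 * R * ‖x - y‖ := by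
  have h1 : ‖x‖ ^ 2 - ‖y‖ ^ 2 = (‖x‖ + ‖y‖) * (‖x‖ - ‖y‖) := by ring
  rw [h1, abs_mul, abs_of_nonneg (by positivity)]
  exact mul_le_mul (by linarith) (abs_norm_sub_norm_le x y) (abs_nonneg _)
    (by linarith [norm_nonneg x])

/-- First-order expansion of `ξ ↦ φ (‖ξ‖²)`, uniform on bounded sets. -/
lemma exists_pos_abs_radial_taylor_le (hφ : ContDiffOn ℝ 1 φ (Ici 0)) {R : ℝ} (hR : 0 ≤ R) {m : ℝ}
    (hm : 0 < m) : ∃ r, 0 < r ∧ ∀ ξ w : E, ‖ξ‖ ≤ R → ‖w‖ ≤ r →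
      |φ (‖ξ + w‖ ^ 2) - φ (‖ξ‖ ^ 2) - 2 * derivWithin φ (Ici 0) (‖ξ‖ ^ 2) * inner ℝ ξ w| ≤
        m * ‖w‖ := by
  obtain ⟨B, hB, hBd⟩ := exists_abs_derivWithin_le hφ ((R + 1) ^ 2)
  obtain ⟨r, hr, h⟩ := exists_pos_abs_taylor_le hφ ((R + 1) ^ 2)
    (show 0 < m / (4 * (R + 1)) by positivity)
  refine ⟨min 1 (min (r / (2 * (R + 1))) (m / (2 * B))), by positivity, fun ξ w hξ hw => ?_⟩
  have hw1 : ‖w‖ ≤ 1 := hw.trans (min_le_left _ _)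
  have hw2 : ‖w‖ ≤ r / (2 * (R + 1)) := hw.trans ((min_le_right _ _).trans (min_le_left _ _))
  have hw3 : ‖w‖ ≤ m / (2 * B) := hw.trans ((min_le_right _ _).trans (min_le_right _ _))
  have hξw : ‖ξ + w‖ ≤ R + 1 := (norm_add_le _ _).trans (add_le_add hξ hw1)
  have hξ' : ‖ξ‖ ≤ R + 1 := by linarith
  have hst : |‖ξ + w‖ ^ 2 - ‖ξ‖ ^ 2| ≤ 2 * (R + 1) * ‖w‖ := by
    simpa using abs_norm_sq_sub_norm_sq_le hξw hξ'
  have hs : ‖ξ‖ ^ 2 ∈ Icc 0 ((R + 1) ^ 2) :=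
    ⟨by positivity, pow_le_pow_left₀ (norm_nonneg _) hξ' 2⟩
  have ht : ‖ξ + w‖ ^ 2 ∈ Icc 0 ((R + 1) ^ 2) :=
    ⟨by positivity, pow_le_pow_left₀ (norm_nonneg _) hξw 2⟩
  have h1 := h _ _ hs ht (hst.trans (by
    rw [le_div_iff₀ (by positivity)] at hw2
    linarith))
  have h2 : m / (4 * (R + 1)) * |‖ξ + w‖ ^ 2 - ‖ξ‖ ^ 2| ≤ m / 2 * ‖w‖ := by
    refine (mul_le_mul_of_nonneg_left hst (by positivity)).trans (le_of_eq ?_)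
    field_simp
    ring
  have h3 : |derivWithin φ (Ici 0) (‖ξ‖ ^ 2) * ‖w‖ ^ 2| ≤ m / 2 * ‖w‖ := by
    rw [abs_mul, abs_of_nonneg (sq_nonneg ‖w‖)]
    rw [le_div_iff₀ (by positivity)] at hw3
    have := mul_le_mul_of_nonneg_right (hBd _ hs) (sq_nonneg ‖w‖)
    nlinarith [norm_nonneg w]
  have h4 : φ (‖ξ + w‖ ^ 2) - φ (‖ξ‖ ^ 2) -
      2 * derivWithin φ (Ici 0) (‖ξ‖ ^ 2) * inner ℝ ξ w =
      (φ (‖ξ + w‖ ^ 2) - φ (‖ξ‖ ^ 2) -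
        derivWithin φ (Ici 0) (‖ξ‖ ^ 2) * (‖ξ + w‖ ^ 2 - ‖ξ‖ ^ 2)) +
        derivWithin φ (Ici 0) (‖ξ‖ ^ 2) * ‖w‖ ^ 2 := by
    rw [norm_add_sq_real]; ring
  rw [h4]
  refine (abs_add_le _ _).trans ?_
  linarith

/-- `x ↦ φ'(‖x‖²) x` is uniformly continuous on bounded sets. -/
lemma exists_pos_norm_radial_grad_sub_le (hφ : ContDiffOn ℝ 1 φ (Ici 0)) {R : ℝ} (hR : 0 ≤ R)
    {m : ℝ} (hm : 0 < m) : ∃ r, 0 < r ∧ ∀ x ξ : E, ‖x‖ ≤ R → ‖ξ‖ ≤ R → ‖x - ξ‖ ≤ r →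
      ‖derivWithin φ (Ici 0) (‖ξ‖ ^ 2) • ξ - derivWithin φ (Ici 0) (‖x‖ ^ 2) • x‖ ≤ m := by
  obtain ⟨B, hB, hBd⟩ := exists_abs_derivWithin_le hφ (R ^ 2)
  obtain ⟨r, hr, h⟩ := exists_pos_abs_derivWithin_sub_le hφ (R ^ 2)
    (show 0 < m / (2 * (R + 1)) by positivity)
  refine ⟨min (r / (2 * (R + 1))) (m / (2 * B)), by positivity, fun x ξ hx hξ hxξ => ?_⟩
  have hw2 : ‖x - ξ‖ ≤ r / (2 * (R + 1)) := hxξ.trans (min_le_left _ _)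
  have hw3 : ‖x - ξ‖ ≤ m / (2 * B) := hxξ.trans (min_le_right _ _)
  rw [le_div_iff₀ (by positivity)] at hw2 hw3
  have hxm : ‖x‖ ^ 2 ∈ Icc 0 (R ^ 2) := ⟨by positivity, pow_le_pow_left₀ (norm_nonneg _) hx 2⟩
  have hξm : ‖ξ‖ ^ 2 ∈ Icc 0 (R ^ 2) := ⟨by positivity, pow_le_pow_left₀ (norm_nonneg _) hξ 2⟩
  have h1 := h _ _ hxm hξm (by
    have := abs_norm_sq_sub_norm_sq_le hξ hx
    rw [norm_sub_rev] at this
    nlinarith [norm_nonneg (x - ξ)])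
  have e : derivWithin φ (Ici 0) (‖ξ‖ ^ 2) • ξ - derivWithin φ (Ici 0) (‖x‖ ^ 2) • x =
      (derivWithin φ (Ici 0) (‖ξ‖ ^ 2) - derivWithin φ (Ici 0) (‖x‖ ^ 2)) • ξ -
        derivWithin φ (Ici 0) (‖x‖ ^ 2) • (x - ξ) := by module
  rw [e]
  refine (norm_sub_le _ _).trans ?_
  rw [norm_smul, norm_smul, Real.norm_eq_abs, Real.norm_eq_abs]
  have h2 := mul_le_mul h1 hξ (norm_nonneg _) (by positivity)
  have h3 := mul_le_mul_of_nonneg_right (hBd _ hxm) (norm_nonneg (x - ξ))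
  have h4 : m / (2 * (R + 1)) * R ≤ m / 2 := by
    rw [div_mul_eq_mul_div, div_le_div_iff₀ (by positivity) (by positivity)]
    nlinarith
  linarith

end Calculus

/-! ### The three-point functional and its perturbed maxima. -/

section Penalization

variable {E : Type*} [NormedAddCommGroup E] [InnerProductSpace ℝ E] {C : Set (E × E)}
  {φ : ℝ → ℝ} {U V : E → ℝ} {a b ε : ℝ}

/-- The doubled functional in the variables `(x, ξ, y)`: the variable `ξ` sits between the points
`x` and `y` and carries the penalization at infinity. -/
noncomputable def doubled (φ : ℝ → ℝ) (U V : E → ℝ) (a b ε : ℝ) (z : E × E × E) : ℝ :=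
  U z.1 + V z.2.2 - a / 2 * ‖z.1 - z.2.1‖ ^ 2 - b / 2 * ‖z.2.1 - z.2.2‖ ^ 2 -
    ε * φ (‖z.2.1‖ ^ 2)

/-- The gradient of `doubled` in the middle variable. -/
noncomputable def doubledGrad (φ : ℝ → ℝ) (a b ε : ℝ) (x ξ y : E) : E :=
  a • (x - ξ) - b • (ξ - y) - (2 * ε * derivWithin φ (Ici 0) (‖ξ‖ ^ 2)) • ξ

omit [InnerProductSpace ℝ E] in
lemma doubled_le {K : ℝ} (hU : ∀ x, |U x| ≤ K) (hV : ∀ x, |V x| ≤ K) (hφ : ∀ r, 0 ≤ r → 0 ≤ φ r)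
    (ha : 0 < a) (hb : 0 < b) (hε : 0 < ε) (z : E × E × E) :
    doubled φ U V a b ε z ≤ 2 * K := by
  have h1 := (abs_le.1 (hU z.1)).2
  have h2 := (abs_le.1 (hV z.2.2)).2
  have h3 := hφ (‖z.2.1‖ ^ 2) (by positivity)
  have h4 : 0 ≤ a / 2 * ‖z.1 - z.2.1‖ ^ 2 := by positivity
  have h5 : 0 ≤ b / 2 * ‖z.2.1 - z.2.2‖ ^ 2 := by positivity
  have h6 : 0 ≤ ε * φ (‖z.2.1‖ ^ 2) := by positivity
  rw [doubled]
  linarith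

omit [InnerProductSpace ℝ E] in
/-- A priori bounds at almost maximal points. The radius does not depend on `a` and `b`. -/
lemma exists_doubled_bounds {K : ℝ} (hU : ∀ x, |U x| ≤ K) (hV : ∀ x, |V x| ≤ K)
    (hφ : ∀ r, 0 ≤ r → 0 ≤ φ r) (hφt : Tendsto φ atTop atTop) (hε : 0 < ε) :
    ∃ R B, 0 < R ∧ 0 < B ∧ ∀ a b, 0 < a → 0 < b → ∀ x ξ y : E,
      doubled φ U V a b ε (0, 0, 0) ≤ doubled φ U V a b ε (x, ξ, y) + 1 →
        ‖ξ‖ ≤ R ∧ a * ‖x - ξ‖ ^ 2 ≤ B ∧ b * ‖ξ - y‖ ^ 2 ≤ B := by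
  -- Comparison with the value at the origin bounds the three penalties together by `4K + εφ(0) +
  -- 1`, whatever `a` and `b` are.
  obtain ⟨R, hR⟩ := (hφt.eventually_gt_atTop ((4 * K + ε * φ 0 + 1) / ε)).exists_forall_of_atTop
  have hK : 0 ≤ K := (abs_nonneg _).trans (hU 0)
  have hφ0 := hφ 0 le_rfl
  refine ⟨max R 1, 2 * (4 * K + ε * φ 0 + 1), by positivity, by positivity,
    fun a b ha hb x ξ y h => ?_⟩
  have h1 := abs_le.1 (hU x)
  have h2 := abs_le.1 (hV y)
  have h1' := abs_le.1 (hU 0)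
  have h2' := abs_le.1 (hV 0)
  have h3 := hφ (‖ξ‖ ^ 2) (by positivity)
  have h4 : 0 ≤ a / 2 * ‖x - ξ‖ ^ 2 := by positivity
  have h5 : 0 ≤ b / 2 * ‖ξ - y‖ ^ 2 := by positivity
  have h6 : 0 ≤ ε * φ (‖ξ‖ ^ 2) := by positivity
  simp only [doubled, sub_self, norm_zero] at h
  norm_num at h
  refine ⟨?_, by linarith, by linarith⟩
  by_contra! hlt
  have h7 : R ≤ ‖ξ‖ ^ 2 := by
    have := le_max_left R 1
    have := le_max_right R 1
    nlinarith
  have h8 := hR _ h7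
  rw [div_lt_iff₀ hε] at h8
  linarith

/-- A lower expansion suffices: it bounds the increase of the functional when the middle variable
moves, and near-maximality limits that increase. -/
lemma exists_pos_doubled_taylor_le (hφ : ContDiffOn ℝ 1 φ (Ici 0)) (ha : 0 < a) (hb : 0 < b)
    (hε : 0 < ε) {R : ℝ} (hR : 0 ≤ R) {m : ℝ} (hm : 0 < m) :
    ∃ r, 0 < r ∧ ∀ x ξ y w : E, ‖ξ‖ ≤ R → ‖w‖ ≤ r →
      doubled φ U V a b ε (x, ξ, y) + inner ℝ (doubledGrad φ a b ε x ξ y) w - m * ‖w‖ ≤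
        doubled φ U V a b ε (x, ξ + w, y) := by
  obtain ⟨r, hr, h⟩ := exists_pos_abs_radial_taylor_le (E := E) hφ hR
    (show 0 < m / (2 * ε) by positivity)
  refine ⟨min r (m / (a + b)), by positivity, fun x ξ y w hξ hw => ?_⟩
  have h1 := (abs_le.1 (h ξ w hξ (hw.trans (min_le_left _ _)))).2
  have h2 := hw.trans (min_le_right _ _)
  rw [le_div_iff₀ (by positivity)] at h2
  have h3 := mul_le_mul_of_nonneg_left h1 hε.le
  have h4 : ε * (m / (2 * ε) * ‖w‖) = m / 2 * ‖w‖ := by field_simp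
  rw [h4] at h3
  have e1 : x - (ξ + w) = (x - ξ) - w := by abel
  have e2 : ξ + w - y = (ξ - y) + w := by abel
  simp only [doubled, doubledGrad]
  rw [e1, e2, norm_sub_sq_real (x - ξ), norm_add_sq_real (ξ - y), inner_sub_left, inner_sub_left,
    inner_smul_left, inner_smul_left, inner_smul_left]
  simp only [conj_trivial]
  nlinarith [mul_le_mul_of_nonneg_right h2 (norm_nonneg w)]

omit [InnerProductSpace ℝ E] in
lemma continuous_comp_norm_sq (hφ : ContinuousOn φ (Ici 0)) :
    Continuous fun ξ : E => φ (‖ξ‖ ^ 2) :=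
  hφ.comp_continuous (by fun_prop) fun ξ => by simp

omit [InnerProductSpace ℝ E] in
lemma upperSemicontinuous_doubled (hU : UpperSemicontinuous U) (hV : UpperSemicontinuous V)
    (hφ : ContinuousOn φ (Ici 0)) : UpperSemicontinuous (doubled (E := E) φ U V a b ε) := by
  have h1 : UpperSemicontinuous fun z : E × E × E => U z.1 := hU.comp continuous_fst
  have h2 : UpperSemicontinuous fun z : E × E × E => V z.2.2 :=
    hV.comp (continuous_snd.comp continuous_snd)
  have h3 : Continuous fun z : E × E × E => φ (‖z.2.1‖ ^ 2) :=
    (continuous_comp_norm_sq hφ).comp (continuous_fst.comp continuous_snd)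
  have h4 : Continuous fun z : E × E × E => - (a / 2 * ‖z.1 - z.2.1‖ ^ 2) -
      b / 2 * ‖z.2.1 - z.2.2‖ ^ 2 - ε * φ (‖z.2.1‖ ^ 2) :=
    Continuous.sub (by fun_prop) (h3.const_mul ε)
  have e : doubled (E := E) φ U V a b ε = fun z => U z.1 + V z.2.2 +
      (-(a / 2 * ‖z.1 - z.2.1‖ ^ 2) - b / 2 * ‖z.2.1 - z.2.2‖ ^ 2 - ε * φ (‖z.2.1‖ ^ 2)) := by
    ext z
    rw [doubled]
    ring
  rw [e]
  exact (h1.add h2).add h4.upperSemicontinuous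

variable [CompleteSpace E]

/-- Almost maximal points of the doubled functional which are exact maxima, up to the Tataru
distance, in the outer variables, and whose middle variable lies in the domain of `C`. -/
theorem IsMDissipative.exists_doubled_max (hC : IsMDissipative C) (hdense : Dense (domain C))
    {K : ℝ} (hU : ∀ x, |U x| ≤ K) (hV : ∀ x, |V x| ≤ K) (hUsc : UpperSemicontinuous U)
    (hVsc : UpperSemicontinuous V) (hφ : ContDiffOn ℝ 1 φ (Ici 0)) (hφ0 : ∀ r, 0 ≤ r → 0 ≤ φ r)
    (hφt : Tendsto φ atTop atTop) (ha : 0 < a) (hb : 0 < b) (hε : 0 < ε) {κ : ℝ} (hκ : 0 < κ) :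
    ∃ (x ξ ζ y : E) (ρ : ℝ), 0 < ρ ∧ ρ ≤ κ ∧ (ξ, ζ) ∈ canonicalRestriction C ∧
      (∀ z, doubled φ U V a b ε z ≤ doubled φ U V a b ε (x, ξ, y) + κ) ∧
      (∀ x', U x' - a / 2 * ‖x' - ξ‖ ^ 2 - ρ * tataruDist C x' x ≤ U x - a / 2 * ‖x - ξ‖ ^ 2) ∧
      (∀ y', V y' - b / 2 * ‖ξ - y'‖ ^ 2 - ρ * tataruDist C y' y ≤ V y - b / 2 * ‖ξ - y‖ ^ 2) ∧
      inner ℝ (doubledGrad φ a b ε x ξ y) ζ ≤ κ ∧ ‖doubledGrad φ a b ε x ξ y‖ ≤ κ := by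
  obtain ⟨R, B, hR, hB, hbound⟩ := exists_doubled_bounds (E := E) hU hV hφ0 hφt hε
  obtain ⟨r, hr, htay⟩ := exists_pos_doubled_taylor_le (U := U) (V := V) (E := E) hφ ha hb hε hR.le
    (half_pos hκ)
  obtain ⟨κ', hκ', hκκ, hκ1, hκr⟩ : ∃ κ', 0 < κ' ∧ κ' ≤ κ ∧ κ' ≤ 1 ∧ κ' ≤ κ / 2 * r :=
    ⟨min (min κ 1) (κ / 2 * r), by positivity, (min_le_left _ _).trans (min_le_left _ _),
      (min_le_left _ _).trans (min_le_right _ _), min_le_right _ _⟩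
  set Φ := doubled φ U V a b ε with hΦ
  have hΦb : BddAbove (range Φ) := ⟨2 * K, by
    rintro _ ⟨z, rfl⟩; exact doubled_le hU hV hφ0 ha hb hε z⟩
  -- an almost maximal point in the domain of `C`
  obtain ⟨_, ⟨⟨x₀, ξ₀, y₀⟩, rfl⟩, hz₀⟩ := exists_lt_of_lt_csSup (range_nonempty Φ)
    (sub_lt_self (sSup (range Φ)) (half_pos hκ'))
  have hcont : Continuous fun ξ => Φ (x₀, ξ, y₀) := by
    have := continuous_comp_norm_sq (E := E) hφ.continuousOn
    simp only [hΦ, doubled]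
    exact Continuous.sub (by fun_prop) (this.const_mul ε)
  obtain ⟨ξ₁, hξ₁, w₁, hw₁⟩ := hdense.inter_open_nonempty _
    (isOpen_lt continuous_const hcont) ⟨ξ₀, hz₀⟩
  -- the penalized functional
  let N : E → ℝ := fun ξ => ⨆ h : Ioi (0 : ℝ), ‖yosida C h ξ‖
  -- An unbounded real supremum defaults to `0`, so finiteness of `N` is imposed separately through
  -- `A`. With it, superlevel sets of `F` are intersections of closed sets over `h`.
  let A : Set (E × E × E) := {z | BddAbove (range fun h : Ioi (0 : ℝ) => ‖yosida C h z.2.1‖)}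
  have hNdom : ∀ {ξ w : E}, (ξ, w) ∈ C →
      BddAbove (range fun h : Ioi (0 : ℝ) => ‖yosida C h ξ‖) ∧ N ξ ≤ ‖w‖ := fun {ξ w} hξ =>
    ⟨⟨‖w‖, by rintro _ ⟨h, rfl⟩; exact hC.norm_yosida_le h.2 hξ⟩,
      ciSup_le fun h => hC.norm_yosida_le h.2 hξ⟩
  obtain ⟨δ, hδ, hδw⟩ : ∃ δ, 0 < δ ∧ δ * ‖w₁‖ ≤ κ' / 2 := by
    refine ⟨κ' / (2 * (‖w₁‖ + 1)), by positivity, ?_⟩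
    rw [div_mul_eq_mul_div, div_le_div_iff₀ (by positivity) (by positivity)]
    nlinarith
  let F : E × E × E → ℝ := fun z => Φ z - δ * N z.2.1
  have hclosed : ∀ c, IsClosed {z | z ∈ A ∧ c ≤ F z} := by
    intro c
    have e : {z | z ∈ A ∧ c ≤ F z} =
        ⋂ h : Ioi (0 : ℝ), (fun z => Φ z + -(δ * ‖yosida C h z.2.1‖)) ⁻¹' Ici c := by
      ext z
      simp only [mem_ofPred_eq, mem_iInter, mem_preimage, mem_Ici]
      constructor
      · rintro ⟨hA, hc⟩ h
        have := mul_le_mul_of_nonneg_left (le_ciSup hA h) hδ.le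
        simp only [F, N] at hc this
        linarith
      · intro hz
        have hz' : ∀ h : Ioi (0 : ℝ), ‖yosida C h z.2.1‖ ≤ (Φ z - c) / δ := fun h => by
          rw [le_div_iff₀ hδ]
          linarith [hz h]
        refine ⟨⟨_, by rintro _ ⟨h, rfl⟩; exact hz' h⟩, ?_⟩
        have := ciSup_le hz'
        rw [le_div_iff₀ hδ] at this
        simp only [F, N]
        linarith
    rw [e]
    refine isClosed_iInter fun h => UpperSemicontinuous.isClosed_preimage
      ((upperSemicontinuous_doubled hUsc hVsc hφ.continuousOn).add
        (Continuous.upperSemicontinuous ?_)) c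
    have := hC.continuous_yosida h.2
    exact (((this.comp (continuous_fst.comp continuous_snd)).norm).const_mul δ).neg
  have hN0 : ∀ ξ, 0 ≤ N ξ := fun ξ => Real.iSup_nonneg fun h => norm_nonneg _
  have hFb : BddAbove (F '' A) := ⟨2 * K, by
    rintro _ ⟨z, -, rfl⟩
    have := doubled_le hU hV hφ0 ha hb hε z
    have := mul_nonneg hδ.le (hN0 z.2.1)
    simp only [F, hΦ]
    linarith⟩
  -- The weight is at most `δ / 2` because near-maximality gives `δ N ξ ≤ κ'`; hence `ρ N ξ ≤ κ /
  -- 2`, although `N ξ` itself is not controlled.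
  obtain ⟨⟨x, ξ, y⟩, hzA, hF₀, hmax⟩ := hC.exists_perturbed_max_prod hdense hclosed hFb
    (show 0 < min κ δ / 2 by positivity) (x₀ := (x₀, ξ₁, y₀)) (hNdom hw₁).1
  set ρ := min κ δ / 2 with hρ
  have hρ0 : 0 < ρ := by positivity
  have hρκ : ρ ≤ κ := by linarith [min_le_left κ δ]
  have hρδ : ρ ≤ δ / 2 := by linarith [min_le_right κ δ]
  have hN1 : δ * N ξ₁ ≤ κ' / 2 := (mul_le_mul_of_nonneg_left (hNdom hw₁).2 hδ.le).trans hδw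
  have hsup : ∀ z, Φ z ≤ Φ (x, ξ, y) - δ * N ξ + κ' := fun z => by
    have h1 := le_csSup hΦb (mem_range_self z)
    simp only [F] at hF₀
    simp only [mem_ofPred_eq] at hξ₁
    linarith
  have hNξ : ρ * N ξ ≤ κ / 2 := by
    have := hsup (x, ξ, y)
    have := mul_le_mul_of_nonneg_right hρδ (hN0 ξ)
    linarith
  have hsup' : ∀ z, Φ z ≤ Φ (x, ξ, y) + κ' := fun z => by
    have := hsup z
    have := mul_nonneg hδ.le (hN0 ξ)
    linarith
  have hξR : ‖ξ‖ ≤ R := (hbound a b ha hb x ξ y ((hsup' _).trans (by linarith))).1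
  obtain ⟨ζ, hζ, hζN, hlim⟩ := hC.exists_canonical (x := ξ) (r := N ξ) fun h hh =>
    le_ciSup hzA ⟨h, hh⟩
  refine ⟨x, ξ, ζ, y, ρ, hρ0, hρκ, hζ, fun z => (hsup' z).trans (by linarith), ?_, ?_, ?_, ?_⟩
  · intro x'
    have := hmax (x', ξ, y) hzA
    simp only [F, hΦ, doubled, tataruDist_self] at this
    linarith
  · intro y'
    have := hmax (x, ξ, y') hzA
    simp only [F, hΦ, doubled, tataruDist_self] at this
    linarith
  -- The competitor replaces `ξ` by its resolvent `ξ + h • yosida C h ξ`. The penalty `N` does not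
  -- increase, since `N (J_h ξ) ≤ ‖yosida C h ξ‖ ≤ N ξ`, and the Tataru cost is at most `ρ h N ξ`.
  -- Dividing by `h` and letting `h → 0` turns the Yosida approximation into `ζ`.
  · refine le_of_forall_pos_le_add fun η hη => ?_
    obtain ⟨m, hm, hmη⟩ : ∃ m, 0 < m ∧ m * N ξ ≤ η := by
      refine ⟨η / (N ξ + 1), div_pos hη (by linarith [hN0 ξ]), ?_⟩
      rw [div_mul_eq_mul_div, div_le_iff₀ (by linarith [hN0 ξ])]
      nlinarith
    obtain ⟨r', hr', htay'⟩ := exists_pos_doubled_taylor_le (U := U) (V := V) (E := E) hφ ha hb hε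
      hR.le hm
    have h0 : Tendsto (fun n : ℕ => 1 / ((n : ℝ) + 1)) atTop (𝓝 0) :=
      tendsto_one_div_add_atTop_nhds_zero_nat
    have hsm : Tendsto (fun n : ℕ => ‖(1 / ((n : ℝ) + 1)) • yosida C (1 / ((n : ℝ) + 1)) ξ‖)
        atTop (𝓝 0) := by simpa using (h0.smul hlim).norm
    refine le_of_tendsto ((tendsto_const_nhds (x := doubledGrad φ a b ε x ξ y)).inner hlim) ?_
    filter_upwards [hsm.eventually (gt_mem_nhds hr')] with n hn
    have hpos : 0 < 1 / ((n : ℝ) + 1) := by positivity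
    generalize 1 / ((n : ℝ) + 1) = h at hn hpos
    have hmem := hC.yosida_mem hpos ξ
    have hle : ‖yosida C h ξ‖ ≤ N ξ := le_ciSup hzA ⟨h, hpos⟩
    have h1 := hmax (x, resolventMap C h ξ, y) (hNdom hmem).1
    have h2 := tataruDist_le_norm C (resolventMap C h ξ) ξ
    have h3 := mul_le_mul_of_nonneg_left ((hNdom hmem).2.trans hle) hδ.le
    rw [resolventMap_eq_add hpos] at h1 h2 h3
    have h4 := htay' x ξ y _ hξR hn.le
    rw [add_sub_cancel_left] at h2
    have h5 := mul_le_mul_of_nonneg_left h2 hρ0.le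
    simp only [F, tataruDist_self] at h1
    rw [← hΦ] at h4
    rw [inner_smul_right] at h4
    rw [norm_smul, Real.norm_of_nonneg hpos.le] at h4 h5
    refine le_of_mul_le_mul_left ?_ hpos
    have h6 := mul_le_mul_of_nonneg_left hle (add_pos hρ0 hm).le
    have h7 : h * ((ρ + m) * ‖yosida C h ξ‖) ≤ h * (κ + η) :=
      mul_le_mul_of_nonneg_left (by linarith) hpos.le
    linarith
  -- A step of length `r` along the gradient gains at least `r‖g‖ - κr/2`, while near-maximality
  -- allows a gain of at most `κ' ≤ κr/2`.
  · rcases (norm_nonneg (doubledGrad φ a b ε x ξ y)).eq_or_lt with h0 | h0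
    · rw [← h0]; exact hκ.le
    set g := doubledGrad φ a b ε x ξ y
    have hn : ‖(r / ‖g‖) • g‖ = r := by
      rw [norm_smul, Real.norm_of_nonneg (by positivity), div_mul_cancel₀ _ h0.ne']
    have h1 := htay x ξ y ((r / ‖g‖) • g) hξR hn.le
    have h2 := hsup' (x, ξ + (r / ‖g‖) • g, y)
    rw [hn, inner_smul_right, real_inner_self_eq_norm_sq] at h1
    have h3 : r / ‖g‖ * ‖g‖ ^ 2 = r * ‖g‖ := by field_simp
    rw [h3] at h1
    refine le_of_mul_le_mul_left ?_ hr
    linarith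

end Penalization

/-! ### The viscosity inequalities with the smoothing and the ball of momenta removed. -/

section Hamiltonian

lemma IsModulus.exists_pos_le {ω : ℝ → ℝ} (hω : IsModulus ω) {τ : ℝ} (hτ : 0 < τ) :
    ∃ r, 0 < r ∧ ∀ s, 0 ≤ s → s ≤ r → ω s ≤ τ := by
  obtain ⟨r, hr, h⟩ := Metric.continuousOn_iff.1 hω.1 0 self_mem_Ici τ hτ
  refine ⟨r / 2, half_pos hr, fun s hs hsr => ?_⟩
  have := h s hs (by rw [Real.dist_eq, sub_zero, abs_of_nonneg hs]; linarith)
  rw [hω.2, Real.dist_eq, sub_zero] at this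
  exact (le_abs_self _).trans this.le

variable {E : Type*} [NormedAddCommGroup E] [InnerProductSpace ℝ E] {C : Set (E × E)}
  {G : E → E → ℝ}

/-- `G` is uniformly continuous in the momentum, at scale `(M, r, τ)`. -/
def MomentumBound (G : E → E → ℝ) (M r τ : ℝ) : Prop :=
  ∀ x p q : E, ‖x‖ + ‖p‖ + ‖q‖ < M → ‖q - p‖ ≤ r → |G x p - G x q| ≤ τ

lemma StructuralCondition.exists_momentumBound (hG : StructuralCondition G) {M τ : ℝ}
    (hM : 0 < M) (hτ : 0 < τ) : ∃ r, 0 < r ∧ MomentumBound G M r τ := by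
  obtain ⟨ω, hω, h⟩ := hG.momentum M hM
  obtain ⟨r, hr, hr'⟩ := hω.exists_pos_le hτ
  exact ⟨r, hr, fun x p q hM' hpq => (h _ x p q (norm_nonneg _) hM' le_rfl).trans
    (hr' _ (norm_nonneg _) hpq)⟩

variable [CompleteSpace E]

lemma gradient_quad (c : ℝ) (ξ x : E) : gradient (quad c ξ) x = c • (x - ξ) := by
  refine HasGradientAt.gradient ?_
  rw [hasGradientAt_iff_hasFDerivAt]
  have h := (((hasFDerivAt_id (𝕜 := ℝ) x).sub_const ξ).norm_sq).const_mul (c / 2)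
  have e : InnerProductSpace.toDual ℝ E (c • (x - ξ)) =
      (c / 2) • 2 • (innerSL ℝ) (id x - ξ) ∘SL ContinuousLinearMap.id ℝ E := by
    ext w
    simp
    ring
  rw [e]
  exact h

/-- On the ball `‖q‖ ≤ ρ` the momentum bound replaces `q` by `0` at cost `τ`; what remains is
continuous in `x`, so the limsup is its value. The norm condition is strict and thus persists near
`x₀`. -/
lemma limsup_hamiltonian_le (hG : StructuralCondition G) {M r τ c ρ : ℝ}
    (hm : MomentumBound G M r τ) {ξ ζ x₀ : E} (hρr : ρ ≤ r)
    (hM : ‖x₀‖ + 2 * ‖c • (x₀ - ξ)‖ + ρ < M) :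
    limsup (fun x => ((c * inner ℝ (x - ξ) ζ + ρ : ℝ) : EReal) +
      ⨆ q ∈ Metric.closedBall (0 : E) ρ, ((G x (gradient (quad c ξ) x + q) : ℝ) : EReal)) (𝓝 x₀) ≤
      ((c * inner ℝ (x₀ - ξ) ζ + ρ + G x₀ (c • (x₀ - ξ)) + τ : ℝ) : EReal) := by
  have hGc := hG.continuous
  have hcont : Continuous fun x => c * inner ℝ (x - ξ) ζ + ρ + G x (c • (x - ξ)) + τ := by
    have : Continuous fun x => G x (c • (x - ξ)) :=
      hGc.comp (by fun_prop : Continuous fun x : E => (x, c • (x - ξ)))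
    fun_prop
  have hlim := (continuous_coe_real_ereal.comp hcont).tendsto x₀
  have hnorm : Continuous fun x : E => ‖x‖ + 2 * ‖c • (x - ξ)‖ + ρ := by fun_prop
  refine le_trans (limsup_le_limsup ?_) hlim.limsup_eq.le
  filter_upwards [(hnorm.tendsto x₀).eventually (gt_mem_nhds hM)] with x hx
  rw [Function.comp_apply, add_assoc (c * _ + ρ), EReal.coe_add (c * _ + ρ)]
  refine add_le_add_right (α := EReal) ?_ _
  refine iSup₂_le fun q hq => ?_
  rw [mem_closedBall_zero_iff] at hq
  rw [gradient_quad, EReal.coe_le_coe_iff]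
  have h1 := norm_add_le (c • (x - ξ)) q
  have h2 := hm x (c • (x - ξ)) (c • (x - ξ) + q) (by linarith)
    (by rw [add_sub_cancel_left]; exact hq.trans hρr)
  linarith [(abs_le.1 h2).1]

lemma le_liminf_hamiltonian (hG : StructuralCondition G) {M r τ c ρ : ℝ}
    (hm : MomentumBound G M r τ) {ξ ζ x₀ : E} (hρr : ρ ≤ r)
    (hM : ‖x₀‖ + 2 * ‖c • (x₀ - ξ)‖ + ρ < M) :
    ((c * inner ℝ (x₀ - ξ) ζ - ρ + (G x₀ (c • (x₀ - ξ)) - τ) : ℝ) : EReal) ≤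
    liminf (fun x => ((c * inner ℝ (x - ξ) ζ - ρ : ℝ) : EReal) +
      ⨅ q ∈ Metric.closedBall (0 : E) ρ, ((G x (gradient (quad c ξ) x + q) : ℝ) : EReal))
      (𝓝 x₀) := by
  have hGc := hG.continuous
  have hcont : Continuous fun x => c * inner ℝ (x - ξ) ζ - ρ + (G x (c • (x - ξ)) - τ) := by
    have : Continuous fun x => G x (c • (x - ξ)) :=
      hGc.comp (by fun_prop : Continuous fun x : E => (x, c • (x - ξ)))
    fun_prop
  have hlim := (continuous_coe_real_ereal.comp hcont).tendsto x₀
  have hnorm : Continuous fun x : E => ‖x‖ + 2 * ‖c • (x - ξ)‖ + ρ := by fun_prop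
  refine le_trans hlim.liminf_eq.ge (liminf_le_liminf ?_)
  filter_upwards [(hnorm.tendsto x₀).eventually (gt_mem_nhds hM)] with x hx
  rw [Function.comp_apply, EReal.coe_add (c * _ - ρ)]
  refine add_le_add_right (α := EReal) ?_ _
  refine le_iInf₂ fun q hq => ?_
  rw [mem_closedBall_zero_iff] at hq
  rw [gradient_quad, EReal.coe_le_coe_iff]
  have h1 := norm_add_le (c • (x - ξ)) q
  have h2 := hm x (c • (x - ξ)) (c • (x - ξ) + q) (by linarith)
    (by rw [add_sub_cancel_left]; exact hq.trans hρr)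
  linarith [(abs_le.1 h2).2]

/-- The perturbed maximum of `l * u` is divided by `l` to give a test function for `u` with
coefficients `a / l` and `ρ / l`; the Tataru distance is based at `x` itself and vanishes there. -/
lemma IsSubsolution.le_hamiltonian (hG : StructuralCondition G) {α : ℝ} {h u : E → ℝ}
    (hu : IsSubsolution (H₀hat C G) α h u) {M r τ a ρ l : ℝ} (hm : MomentumBound G M r τ)
    (ha : 0 < a) (hρ : 0 < ρ) (hl : 0 < l) {ξ ζ x : E} (hξ : (ξ, ζ) ∈ canonicalRestriction C)
    (hρr : ρ / l ≤ r) (hM : ‖x‖ + 2 * ‖l⁻¹ • a • (x - ξ)‖ + ρ / l < M)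
    (hmax : ∀ x', l * u x' - a / 2 * ‖x' - ξ‖ ^ 2 - ρ * tataruDist C x' x ≤
      l * u x - a / 2 * ‖x - ξ‖ ^ 2) :
    α⁻¹ * (l * (u x - h x)) ≤
      a * inner ℝ (x - ξ) ζ + ρ + l * G x (l⁻¹ • a • (x - ξ)) + l * τ := by
  have e : ∀ y : E, l⁻¹ • a • y = (a / l) • y := fun y => by rw [smul_smul, inv_mul_eq_div]
  rw [e] at hM ⊢
  have h1 := hu.2.2 x _ _ ⟨a / l, ρ / l, ξ, ζ, x, by positivity, by positivity, hξ, rfl, rfl⟩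
    fun x' => by
      have h2 := mul_le_mul_of_nonneg_left (hmax x') (inv_pos.2 hl).le
      have e1 : ∀ s t d : ℝ, l⁻¹ * (l * s - a / 2 * t - ρ * d) =
          s - (a / l / 2 * t + ρ / l * d) := fun s t d => by field_simp; ring
      have e2 := e1 (u x) (‖x - ξ‖ ^ 2) 0
      rw [mul_zero, sub_zero] at e2
      rw [e1, e2] at h2
      simpa only [quad, tataruDist_self] using h2
  have h2 := h1.trans (limsup_hamiltonian_le hG hm hρr hM)
  rw [EReal.coe_le_coe_iff] at h2
  have h3 := mul_le_mul_of_nonneg_left h2 hl.le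
  have e3 : l * (a / l * inner ℝ (x - ξ) ζ + ρ / l + G x ((a / l) • (x - ξ)) + τ) =
      a * inner ℝ (x - ξ) ζ + ρ + l * G x ((a / l) • (x - ξ)) + l * τ := by field_simp
  linarith

lemma IsSupersolution.hamiltonian_le (hG : StructuralCondition G) {α : ℝ} {h v : E → ℝ}
    (hv : IsSupersolution (H₁hat C G) α h v) {M r τ b ρ : ℝ} (hm : MomentumBound G M r τ)
    (hb : 0 < b) (hρ : 0 < ρ) {ξ ζ y : E} (hξ : (ξ, ζ) ∈ canonicalRestriction C)
    (hρr : ρ ≤ r) (hM : ‖y‖ + 2 * ‖b • (ξ - y)‖ + ρ < M)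
    (hmax : ∀ y', -v y' - b / 2 * ‖ξ - y'‖ ^ 2 - ρ * tataruDist C y' y ≤
      -v y - b / 2 * ‖ξ - y‖ ^ 2) :
    b * inner ℝ (ξ - y) ζ - ρ + G y (b • (ξ - y)) - τ ≤ α⁻¹ * (v y - h y) := by
  have e : (-b) • (y - ξ) = b • (ξ - y) := by module
  have h1 := hv.2.2 y _ _ ⟨b, ρ, ξ, ζ, y, hb, hρ, hξ, rfl, rfl⟩ fun y' => by
    have := hmax y'
    simp only [quad, tataruDist_self]
    rw [norm_sub_rev y' ξ, norm_sub_rev y ξ]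
    linarith
  have h2 := (le_liminf_hamiltonian hG hm (c := -b) hρr (by rwa [e])).trans h1
  rw [EReal.coe_le_coe_iff, e] at h2
  have e2 : (-b) * inner ℝ (y - ξ) ζ = b * inner ℝ (ξ - y) ζ := by
    rw [← neg_sub ξ y, inner_neg_left]; ring
  linarith

end Hamiltonian

/-! ### Combining the two viscosity inequalities. -/

section Comparison

lemma eventually_mul_le (k : ℝ) {c : ℝ} (hc : 0 < c) : ∀ᶠ s in 𝓝[>] (0 : ℝ), k * s ≤ c := by
  have h : Tendsto (fun s : ℝ => k * s) (𝓝[>] 0) (𝓝 (k * 0)) :=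
    ((continuous_const.mul continuous_id).tendsto 0).mono_left nhdsWithin_le_nhds
  rw [mul_zero] at h
  exact (h.eventually (gt_mem_nhds hc)).mono fun s hs => le_of_lt hs

variable {E : Type*} [NormedAddCommGroup E] [InnerProductSpace ℝ E] [CompleteSpace E]
  {C : Set (E × E)} {G : E → E → ℝ}

/-- Almost maximal points of the penalized doubled difference of a sub- and a supersolution at
which the two viscosity inequalities combine to an inequality for `G` alone. -/
theorem exists_quasi_optimal (hC : IsMDissipative C) (hdense : Dense (domain C))
    (hzero : ((0 : E), (0 : E)) ∈ C) (hG : StructuralCondition G) {α : ℝ} {h u v : E → ℝ}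
    (hu : IsSubsolution (H₀hat C G) α h u) (hv : IsSupersolution (H₁hat C G) α h v)
    {φ : ℝ → ℝ} (hφ : IsSlowlyGrowing φ) {l b ε τ : ℝ} (hl : 0 < l) (hb : 0 < b) (hε : 0 < ε)
    (hτ : 0 < τ) :
    ∃ x y : E, (∀ x' y', l * u x' - v y' - b / 2 * ‖x' - y'‖ ^ 2 - ε * φ (‖x'‖ ^ 2) ≤
        l * u x - v y - b / 2 * ‖x - y‖ ^ 2 - ε * φ (‖x‖ ^ 2) + τ) ∧
      α⁻¹ * (l * (u x - h x)) - α⁻¹ * (v y - h y) ≤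
        l * G x (l⁻¹ • (b • (x - y) + (2 * ε * derivWithin φ (Ici 0) (‖x‖ ^ 2)) • x)) -
          G y (b • (x - y)) + τ := by
  obtain ⟨hφd, -, hφ0, hφ', hφt, -⟩ := hφ
  obtain ⟨K₁, hK₁⟩ := hu.1
  obtain ⟨K₂, hK₂⟩ := hv.1
  have hU : ∀ x, |l * u x| ≤ max (l * K₁) K₂ := fun x => by
    rw [abs_mul, abs_of_pos hl]
    exact (mul_le_mul_of_nonneg_left (hK₁ x) hl.le).trans (le_max_left _ _)
  have hV : ∀ x, |-v x| ≤ max (l * K₁) K₂ := fun x => by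
    rw [abs_neg]
    exact (hK₂ x).trans (le_max_right _ _)
  have hUsc : UpperSemicontinuous fun x => l * u x :=
    (continuous_const_mul l).comp_upperSemicontinuous hu.2.1
      fun _ _ hst => mul_le_mul_of_nonneg_left hst hl.le
  have hVsc : UpperSemicontinuous fun x => -v x :=
    continuous_neg.comp_lowerSemicontinuous_antitone hv.2.1 fun _ _ hst => neg_le_neg hst
  obtain ⟨R, B, hR, hB, hbound⟩ := exists_doubled_bounds (E := E) hU hV hφ0 hφt hε
  obtain ⟨B', hB', hBd⟩ := exists_abs_derivWithin_le hφd ((R + 1) ^ 2)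
  have hBd' : ∀ x : E, ‖x‖ ≤ R + 1 → |derivWithin φ (Ici 0) (‖x‖ ^ 2)| ≤ B' := fun x hx =>
    hBd _ ⟨by positivity, pow_le_pow_left₀ (norm_nonneg _) hx 2⟩
  obtain ⟨D, hD, hBD⟩ : ∃ D, 0 < D ∧ B ≤ b * D ^ 2 := by
    refine ⟨B / b + 1, by positivity, ?_⟩
    have : b * (B / b + 1) ^ 2 = B * (B / b) + 2 * B + b := by
      field_simp
      ring
    have : 0 ≤ B * (B / b) := by positivity
    linarith
  -- `P` bounds all momenta before scaling by `l⁻¹`, including `a • (x - ξ)`. It does not involve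
  -- `a`, so the momentum scale `r` can be fixed before `a` is sent to infinity.
  set P := 1 + b * (D + 1) + 2 * ε * B' * (R + 1) with hP
  have hP0 : 0 < P := by positivity
  set τ₁ := τ / (4 * (l + 1)) with hτ₁
  obtain ⟨r, hr, hmom⟩ := hG.exists_momentumBound
    (show 0 < R + 1 + D + 2 * (1 + l⁻¹) * P + 2 by positivity) (show 0 < τ₁ by positivity)
  obtain ⟨r₁, hr₁, hgrad⟩ := exists_pos_norm_radial_grad_sub_le (E := E) hφd
    (show 0 ≤ R + 1 by positivity) (show 0 < l * r / (6 * ε) by positivity)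
  obtain ⟨r₂, hr₂, htay⟩ := exists_pos_abs_radial_taylor_le (E := E) hφd hR.le one_pos
  obtain ⟨κ, hκ, hκ1, hκl, hκr, hκlr, hκτ⟩ : ∃ κ : ℝ, 0 < κ ∧ 1 * κ ≤ 1 ∧ 1 * κ ≤ l ∧ 1 * κ ≤ r ∧
      3 * κ ≤ l * r ∧ 6 * κ ≤ τ :=
    (((eventually_mem_nhdsWithin (a := (0 : ℝ)) (s := Ioi 0)).and
      ((eventually_mul_le 1 one_pos).and ((eventually_mul_le 1 hl).and
      ((eventually_mul_le 1 hr).and ((eventually_mul_le 3 (mul_pos hl hr)).and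
      (eventually_mul_le 6 hτ)))))).exists)
  obtain ⟨s, hs, hs1, hsr₁, hsr₂, hsl, hsr, hsD, hsB⟩ : ∃ s : ℝ, 0 < s ∧ 1 * s ≤ 1 ∧ 1 * s ≤ r₁ ∧
      1 * s ≤ r₂ ∧ (3 * b) * s ≤ l * r ∧ b * s ≤ r ∧ (4 * b * (D + 1)) * s ≤ τ ∧
      (4 * ε * (2 * B' * R + 1)) * s ≤ τ :=
    (((eventually_mem_nhdsWithin (a := (0 : ℝ)) (s := Ioi 0)).and
      ((eventually_mul_le 1 one_pos).and ((eventually_mul_le 1 hr₁).and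
      ((eventually_mul_le 1 hr₂).and ((eventually_mul_le _ (mul_pos hl hr)).and
      ((eventually_mul_le b hr).and ((eventually_mul_le _ hτ).and
      (eventually_mul_le _ hτ)))))))).exists)
  rw [one_mul] at hκ1 hκl hκr hs1 hsr₁ hsr₂
  -- Since `a‖x - ξ‖² ≤ B` with `B` independent of `a`, this choice of `a` gives `‖x - ξ‖ ≤ s`.
  have ha : 0 < B / s ^ 2 := by positivity
  obtain ⟨x, ξ, ζ, y, ρ, hρ, hρκ, hζ, hsup, hx, hy, hgζ, hg⟩ :=
    hC.exists_doubled_max hdense hU hV hUsc hVsc hφd hφ0 hφt ha hb hε hκ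
  obtain ⟨hξR, hxξ, hξy⟩ := hbound _ b ha hb x ξ y ((hsup _).trans (by linarith))
  set a := B / s ^ 2
  have hxs : ‖x - ξ‖ ≤ s := by
    refine le_of_sq_le_sq ?_ hs.le
    have : a * s ^ 2 = B := div_mul_cancel₀ _ (by positivity)
    rw [← this] at hxξ
    exact le_of_mul_le_mul_left hxξ ha
  have hξyD : ‖ξ - y‖ ≤ D :=
    le_of_sq_le_sq (le_of_mul_le_mul_left (hξy.trans hBD) hb) hD.le
  have hxR : ‖x‖ ≤ R + 1 := by
    have := norm_le_norm_add_norm_sub' x ξ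
    linarith
  have hyR : ‖y‖ ≤ R + D := by
    have := norm_le_norm_add_norm_sub ξ y
    linarith
  have hxyD : ‖x - y‖ ≤ D + 1 := by
    have := norm_sub_le_norm_sub_add_norm_sub x ξ y
    linarith
  set dξ := derivWithin φ (Ici 0) (‖ξ‖ ^ 2)
  set dx := derivWithin φ (Ici 0) (‖x‖ ^ 2)
  have hdξ : |dξ| ≤ B' := hBd' ξ (by linarith)
  have hdx : |dx| ≤ B' := hBd' x hxR
  -- bounds for the momenta
  have hnb : ∀ w : E, ‖b • w‖ = b * ‖w‖ := fun w => by
    rw [norm_smul, Real.norm_of_nonneg hb.le]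
  have hnd : ∀ (d : ℝ) (w : E), |d| ≤ B' → ‖w‖ ≤ R + 1 →
      ‖(2 * ε * d) • w‖ ≤ 2 * ε * B' * (R + 1) := fun d w hd hw => by
    rw [norm_smul, Real.norm_eq_abs, abs_mul, abs_of_pos (by positivity : 0 < 2 * ε)]
    exact mul_le_mul (mul_le_mul_of_nonneg_left hd (by positivity)) hw (norm_nonneg _)
      (by positivity)
  -- Smallness of the gradient trades the momentum with the large factor `a` for bounded ones.
  have e1 : a • (x - ξ) = doubledGrad φ a b ε x ξ y + b • (ξ - y) + (2 * ε * dξ) • ξ := by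
    rw [doubledGrad]; abel
  have hpx : ‖a • (x - ξ)‖ ≤ P := by
    rw [e1]
    have h1 := norm_add₃_le (a := doubledGrad φ a b ε x ξ y) (b := b • (ξ - y))
      (c := (2 * ε * dξ) • ξ)
    have h2 := hnd dξ ξ hdξ (by linarith)
    rw [hnb] at h1
    have := mul_le_mul_of_nonneg_left hξyD hb.le
    linarith
  have hpx' : ‖b • (x - y) + (2 * ε * dx) • x‖ ≤ P := by
    have h1 := norm_add_le (b • (x - y)) ((2 * ε * dx) • x)
    have h2 := hnd dx x hdx hxR
    rw [hnb] at h1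
    have := mul_le_mul_of_nonneg_left hxyD hb.le
    linarith
  have hεP : 0 ≤ 2 * ε * B' * (R + 1) := by positivity
  have hpy : ‖b • (ξ - y)‖ ≤ P := by
    rw [hnb]
    have := mul_le_mul_of_nonneg_left hξyD hb.le
    linarith
  have hpy' : ‖b • (x - y)‖ ≤ P := by
    rw [hnb]
    have := mul_le_mul_of_nonneg_left hxyD hb.le
    linarith
  have hnl : ∀ w : E, ‖l⁻¹ • w‖ = l⁻¹ * ‖w‖ := fun w => by
    rw [norm_smul, Real.norm_of_nonneg (inv_pos.2 hl).le]
  have hlP : ∀ w : E, ‖w‖ ≤ P → ‖l⁻¹ • w‖ ≤ l⁻¹ * P := fun w hw => by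
    rw [hnl]
    exact mul_le_mul_of_nonneg_left hw (inv_pos.2 hl).le
  have hlP0 : 0 ≤ l⁻¹ * P := by positivity
  have hdiff : ‖l⁻¹ • (b • (x - y) + (2 * ε * dx) • x) - l⁻¹ • a • (x - ξ)‖ ≤ r := by
    rw [← smul_sub, hnl, inv_mul_le_iff₀ hl]
    have e2 : b • (x - y) + (2 * ε * dx) • x - a • (x - ξ) =
        b • (x - ξ) - doubledGrad φ a b ε x ξ y - (2 * ε) • (dξ • ξ - dx • x) := by
      rw [e1]; module
    rw [e2]
    have h1 := norm_sub_le (b • (x - ξ) - doubledGrad φ a b ε x ξ y)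
      ((2 * ε) • (dξ • ξ - dx • x))
    have h2 := norm_sub_le (b • (x - ξ)) (doubledGrad φ a b ε x ξ y)
    have h3 := hgrad x ξ hxR (by linarith) (hxs.trans hsr₁)
    rw [norm_smul (2 * ε), Real.norm_of_nonneg (by positivity)] at h1
    rw [hnb] at h2
    have h4 := mul_le_mul_of_nonneg_left h3 (show 0 ≤ 2 * ε by positivity)
    have h5 : 2 * ε * (l * r / (6 * ε)) = l * r / 3 := by field_simp; norm_num
    have h6 := mul_le_mul_of_nonneg_left hxs hb.le
    linarith
  have hdiff' : ‖b • (ξ - y) - b • (x - y)‖ ≤ r := by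
    rw [← smul_sub, sub_sub_sub_cancel_right, hnb, norm_sub_rev]
    exact (mul_le_mul_of_nonneg_left hxs hb.le).trans hsr
  have hGx := hmom x _ _ (by
    have := hlP _ hpx
    have := hlP _ hpx'
    linarith) hdiff
  have hGy := hmom y _ _ (by
    have := hpy
    have := hpy'
    linarith) hdiff'
  refine ⟨x, y, fun x' y' => ?_, ?_⟩
  -- Competitors with middle point `x'` carry no `a`-penalty, and replacing `ξ` by `x` in the
  -- remaining penalties costs only multiples of `s`.
  · have h1 := hsup (x', x', y')
    simp only [doubled, sub_self, norm_zero] at h1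
    have h2 : 0 ≤ a / 2 * ‖x - ξ‖ ^ 2 := by positivity
    have h3 := (abs_le.1 (htay ξ (x - ξ) hξR (hxs.trans hsr₂))).2
    rw [add_sub_cancel] at h3
    have h4 : dξ * inner ℝ ξ (x - ξ) ≤ B' * (R * s) := by
      refine (le_abs_self _).trans ?_
      rw [abs_mul]
      exact mul_le_mul hdξ ((abs_real_inner_le_norm _ _).trans
        (mul_le_mul hξR hxs (norm_nonneg _) hR.le)) (abs_nonneg _) hB'.le
    have h5 : φ (‖x‖ ^ 2) - φ (‖ξ‖ ^ 2) ≤ (2 * B' * R + 1) * s := by linarith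
    have h6 := mul_le_mul_of_nonneg_left h5 hε.le
    have h7 := (abs_le.1 (abs_norm_sq_sub_norm_sq_le hxyD
      (hξyD.trans (le_add_of_nonneg_right zero_le_one)))).2
    rw [sub_sub_sub_cancel_right] at h7
    have h8 : b / 2 * (‖x - y‖ ^ 2 - ‖ξ - y‖ ^ 2) ≤ b / 2 * (2 * (D + 1) * s) :=
      mul_le_mul_of_nonneg_left (h7.trans
        (mul_le_mul_of_nonneg_left hxs (by positivity))) (by positivity)
    norm_num at h1
    linarith
  · have h1 := hu.le_hamiltonian hG hmom ha hρ hl hζ (by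
      rw [div_le_iff₀ hl]; linarith) (by
      have := hlP _ hpx
      have : ρ / l ≤ 1 := by rw [div_le_one hl]; linarith
      linarith) hx
    have h2 := hv.hamiltonian_le hG hmom hb hρ hζ (by linarith) (by
      linarith) hy
    -- The difference is `⟨doubledGrad, ζ⟩ + 2εφ'(‖ξ‖²)⟨ξ, ζ⟩`; dissipativity against `(0, 0)` makes
    -- `⟨ξ, ζ⟩ ≤ 0`.
    have h3 : a * inner ℝ (x - ξ) ζ - b * inner ℝ (ξ - y) ζ ≤ κ := by
      have h4 : inner ℝ ξ ζ ≤ 0 := by simpa using hC.1 _ _ _ _ hζ.1 hzero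
      have h5 : 0 ≤ 2 * ε * dξ := by
        have : 0 < dξ := hφ' _ (by positivity)
        positivity
      have h6 : 2 * ε * derivWithin φ (Ici 0) (‖ξ‖ ^ 2) * inner ℝ ξ ζ ≤ 0 :=
        mul_nonpos_of_nonneg_of_nonpos h5 h4
      rw [doubledGrad, inner_sub_left, inner_sub_left, inner_smul_left, inner_smul_left,
        inner_smul_left] at hgζ
      simp only [conj_trivial] at hgζ
      linarith
    have h4 := mul_le_mul_of_nonneg_left (abs_le.1 hGx).2 hl.le
    have h5 := (abs_le.1 hGy).2
    have h6 : l * τ₁ + τ₁ = τ / 4 := by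
      rw [hτ₁]; field_simp
    change _ ≤ l * G x (l⁻¹ • (b • (x - y) + (2 * ε * dx) • x)) - _ + τ
    linarith

end Comparison

/-! ### Choice of the doubling parameter. -/

section Doubling

variable {E : Type*} [NormedAddCommGroup E]

/-- The doubling lemma: for some large `b`, almost maximal points of
`f x + g y - (b / 2) ‖x - y‖²` satisfy `b ‖x - y‖² ≤ η`. -/
lemma exists_doubling_parameter {f g : E → ℝ} {K : ℝ} (hf : ∀ x, f x ≤ K) (hg : ∀ x, g x ≤ K)
    {η : ℝ} (hη : 0 < η) : ∃ b, 1 ≤ b ∧ ∃ x₁ y₁ : E, (∀ z, f z + g z - η / 16 ≤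
        f x₁ + g y₁ - b / 2 * ‖x₁ - y₁‖ ^ 2) ∧
      ∀ x y, f x₁ + g y₁ - b / 2 * ‖x₁ - y₁‖ ^ 2 - η / 16 ≤ f x + g y - b / 2 * ‖x - y‖ ^ 2 →
        b * ‖x - y‖ ^ 2 ≤ η := by
  let Ψ : ℝ → E × E → ℝ := fun b p => f p.1 + g p.2 - b / 2 * ‖p.1 - p.2‖ ^ 2
  have hbdd : ∀ b, 0 ≤ b → BddAbove (range (Ψ b)) := fun b hb => ⟨2 * K, by
    rintro _ ⟨p, rfl⟩
    have := hf p.1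
    have := hg p.2
    have : 0 ≤ b / 2 * ‖p.1 - p.2‖ ^ 2 := by positivity
    simp only [Ψ]
    linarith⟩
  -- The suprema decrease and are bounded below, so some consecutive gap is below `η / 8`. Halving
  -- the penalty at an almost maximal point for `2 ^ (n + 1)` then gains at most `η / 4`, which is
  -- the bound on `b‖x - y‖²`.
  let S : ℕ → ℝ := fun n => ⨆ p, Ψ (2 ^ n) p
  have hanti : Antitone S := antitone_nat_of_succ_le fun n => by
    refine ciSup_le fun p => le_trans ?_ (le_ciSup (hbdd (2 ^ n) (by positivity)) p)
    have : 0 ≤ (2 : ℝ) ^ n / 2 * ‖p.1 - p.2‖ ^ 2 := by positivity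
    simp only [Ψ, pow_succ]
    linarith
  have hlow : BddBelow (range S) := ⟨f 0 + g 0, by
    rintro _ ⟨n, rfl⟩
    have := le_ciSup (hbdd (2 ^ n) (by positivity)) ((0 : E), (0 : E))
    simpa [Ψ] using this⟩
  have hlim := tendsto_atTop_ciInf hanti hlow
  have hdiff : Tendsto (fun n => S n - S (n + 1)) atTop (𝓝 0) := by
    simpa using hlim.sub (hlim.comp (tendsto_add_atTop_nat 1))
  obtain ⟨n, hn⟩ := (hdiff.eventually (gt_mem_nhds (show 0 < η / 8 by positivity))).exists
  obtain ⟨⟨x₁, y₁⟩, hp⟩ := exists_lt_of_lt_ciSup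
    (sub_lt_self (S (n + 1)) (show 0 < η / 16 by positivity))
  refine ⟨2 ^ (n + 1), one_le_pow₀ one_le_two, x₁, y₁, fun z => ?_, fun x y hxy => ?_⟩
  · have := le_ciSup (hbdd (2 ^ (n + 1)) (by positivity)) (z, z)
    simp only [Ψ, sub_self, norm_zero] at this hp
    norm_num at this
    simp only [S, Ψ] at hp
    linarith
  · have h1 := le_ciSup (hbdd (2 ^ n) (by positivity)) (x, y)
    change _ ≤ S n at h1
    simp only [Ψ] at h1 hp
    rw [pow_succ] at *
    linarith

end Doubling

/-! ### Order of the parameters and the final contradiction. -/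

section ComparisonPrinciple

/-- **Comparison principle** for bounded sub- and supersolutions. -/
theorem comparison {E : Type*} [NormedAddCommGroup E] [InnerProductSpace ℝ E] [CompleteSpace E]
    {C : Set (E × E)} (hC : IsMDissipative C)
    (hdense : Dense (domain C)) (hzero : ((0 : E), (0 : E)) ∈ C)
    {G : E → E → ℝ} (hG : StructuralCondition G)
    {α : ℝ} (hα : 0 < α)
    {h : E → ℝ} (hbdd : ∃ K : ℝ, ∀ x, |h x| ≤ K) (hunif : UniformContinuous h)
    {fbar funder : E → ℝ}
    (hsub : IsSubsolution (H₀hat C G) α h fbar)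
    (hsuper : IsSupersolution (H₁hat C G) α h funder) :
    ∀ x, fbar x ≤ funder x := by
  intro z
  by_contra! hlt
  obtain ⟨c, hc, hcz⟩ : ∃ c, 0 < c ∧ fbar z - funder z = c := ⟨_, sub_pos.2 hlt, rfl⟩
  obtain ⟨φ, hφ, hgrowth⟩ := hG.growth
  obtain ⟨K, hK, hu, hv, hh⟩ : ∃ K, 0 < K ∧ (∀ x, |fbar x| ≤ K) ∧ (∀ x, |funder x| ≤ K) ∧
      ∀ x, |h x| ≤ K := by
    obtain ⟨K₁, h₁⟩ := hsub.1
    obtain ⟨K₂, h₂⟩ := hsuper.1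
    obtain ⟨K₃, h₃⟩ := hbdd
    exact ⟨max 1 (max K₁ (max K₂ K₃)), by positivity, fun x => (h₁ x).trans (by simp),
      fun x => (h₂ x).trans (by simp), fun x => (h₃ x).trans (by simp)⟩
  -- the scaling factor
  obtain ⟨l, hl1, hl2, hlK⟩ : ∃ l : ℝ, 1 < l ∧ l ≤ 2 ∧ (l * l - 1) * K ≤ c / 8 := by
    obtain ⟨t, ht, ht1, htK⟩ := ((eventually_mem_nhdsWithin (a := (0 : ℝ)) (s := Ioi 0)).and
      ((eventually_mul_le 1 one_pos).and
        (eventually_mul_le (3 * K) (show 0 < c / 8 by positivity)))).exists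
    rw [mem_Ioi] at ht
    refine ⟨1 + t, by linarith, by linarith, le_trans ?_ htK⟩
    have : t * t ≤ t := by nlinarith
    nlinarith
  have hl0 : 0 < l := by linarith
  have hll : 0 < l * l := by positivity
  set τ₀ := c / (16 * α) with hτ₀
  have hτ₀p : 0 < τ₀ := by positivity
  obtain ⟨ω, hω, hdoub⟩ := hG.doubling l hl1
  obtain ⟨r, hr, hωr⟩ := hω.exists_pos_le hτ₀p
  obtain ⟨r', hr', hhr⟩ := Metric.uniformContinuous_iff.1 hunif (c / 8) (by positivity)
  obtain ⟨s, hs, hsr, hsr'⟩ : ∃ s, 0 < s ∧ s ≤ r / 2 ∧ s ≤ r' / 2 :=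
    ⟨min (r / 2) (r' / 2), by positivity, min_le_left _ _, min_le_right _ _⟩
  obtain ⟨η, hη, hηs, hηr, hηc⟩ : ∃ η, 0 < η ∧ η ≤ s ^ 2 ∧ η ≤ r / 2 ∧ η ≤ c :=
    ⟨min (s ^ 2) (min (r / 2) c), by positivity, min_le_left _ _,
      (min_le_right _ _).trans (min_le_left _ _), (min_le_right _ _).trans (min_le_right _ _)⟩
  -- the doubling parameter
  obtain ⟨b, hb1, x₁, y₁, hx₁, hnear⟩ := exists_doubling_parameter
    (f := fun x => l * l * fbar x) (g := fun x => -funder x) (K := l * l * K + K)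
    (fun x => by
      have := mul_le_mul_of_nonneg_left (abs_le.1 (hu x)).2 hll.le
      linarith)
    (fun x => by
      have := (abs_le.1 (hv x)).1
      have : 0 ≤ l * l * K := by positivity
      linarith) hη
  have hb : 0 < b := by linarith
  -- The growth modulus depends on the momentum bound `b * s`, so `ε` is chosen only after `b`.
  obtain ⟨γ, hγ, hgr⟩ := hgrowth (b * s) l (by positivity) hl1
  obtain ⟨r'', hr'', hγr⟩ := hγ.exists_pos_le hτ₀p
  -- the penalization parameter
  obtain ⟨ε, hε, hεφ, hεr⟩ := ((eventually_mem_nhdsWithin (a := (0 : ℝ)) (s := Ioi 0)).and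
    ((eventually_mul_le (φ (‖x₁‖ ^ 2)) (show 0 < η / 32 by positivity)).and
      (eventually_mul_le (2 / l) hr''))).exists
  rw [mem_Ioi] at hε
  obtain ⟨x, y, hmax, hineq⟩ := exists_quasi_optimal hC hdense hzero hG hsub hsuper hφ hll hb hε
    (show 0 < min (η / 32) τ₀ by positivity)
  have hτη := min_le_left (η / 32) τ₀
  have hττ := min_le_right (η / 32) τ₀
  have hφx : 0 ≤ ε * φ (‖x‖ ^ 2) := mul_nonneg hε.le (hφ.2.2.1 _ (by positivity))
  have hval : l * l * fbar x₁ + -funder y₁ - b / 2 * ‖x₁ - y₁‖ ^ 2 - η / 16 ≤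
      l * l * fbar x + -funder y - b / 2 * ‖x - y‖ ^ 2 := by
    have := hmax x₁ y₁
    linarith
  have hbxy := hnear x y hval
  have hxys : ‖x - y‖ ≤ s := by
    refine le_of_sq_le_sq ?_ hs.le
    have := mul_le_mul_of_nonneg_right hb1 (sq_nonneg ‖x - y‖)
    linarith
  have hbxy0 : 0 ≤ b * ‖x - y‖ ^ 2 := by positivity
  have hG1 : l * G x (l⁻¹ • b • (x - y)) - G y (b • (x - y)) ≤ τ₀ :=
    (hdoub b x y hb).trans (hωr _ (by positivity) (by linarith))
  have hG2 : l * G x (l⁻¹ • (l⁻¹ • b • (x - y) +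
      (2 / l * ε * derivWithin φ (Ici 0) (‖x‖ ^ 2)) • x)) - G x (l⁻¹ • b • (x - y)) ≤ τ₀ := by
    refine (hgr _ x _ (by positivity) ?_).trans (hγr _ (by positivity) hεr)
    rw [norm_smul, norm_smul, Real.norm_of_nonneg (inv_pos.2 hl0).le, Real.norm_of_nonneg hb.le]
    have h1 : l⁻¹ ≤ 1 := inv_le_one_of_one_le₀ hl1.le
    have h2 := mul_le_mul_of_nonneg_left hxys hb.le
    exact (mul_le_of_le_one_left (by positivity) h1).trans h2
  -- The factor `l * l` is split: the inner `l⁻¹` scales the momentum for the doubling condition,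
  -- and the outer one serves the growth condition with parameter `2 / l * ε`.
  have harg : (l * l)⁻¹ • (b • (x - y) + (2 * ε * derivWithin φ (Ici 0) (‖x‖ ^ 2)) • x) =
      l⁻¹ • (l⁻¹ • b • (x - y) + (2 / l * ε * derivWithin φ (Ici 0) (‖x‖ ^ 2)) • x) := by
    rw [mul_inv, mul_smul, smul_add l⁻¹ (b • (x - y)), smul_smul l⁻¹ (2 * ε * _)]
    congr 3
    ring
  rw [harg] at hineq
  have hG3 := mul_le_mul_of_nonneg_left hG2 hl0.le
  have hG4 := mul_le_mul_of_nonneg_right hl2 hτ₀p.le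
  have hfin : α⁻¹ * (l * l * (fbar x - h x) - (funder y - h y)) ≤ 4 * τ₀ := by linarith
  rw [inv_mul_le_iff₀ hα] at hfin
  have hατ : α * (4 * τ₀) = c / 4 := by
    rw [hτ₀]; field_simp; norm_num
  have hhxy := hhr (a := x) (b := y) (by rw [dist_eq_norm]; linarith)
  rw [Real.dist_eq] at hhxy
  have h1 := (abs_lt.1 hhxy).2
  have hll1 : 0 ≤ l * l - 1 := by nlinarith
  have h2 := mul_le_mul_of_nonneg_left (abs_le.1 (hh x)).2 hll1
  have h3 := mul_le_mul_of_nonneg_left (abs_le.1 (hu z)).1 hll1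
  have h4 := hx₁ z
  have h5 : 0 ≤ b / 2 * ‖x - y‖ ^ 2 := by positivity
  -- The viscosity bound and the two `h` errors give at most `c/4 + c/8 + c/8 = c/2` for `l²u(x) -
  -- v(y)`, while near-maximality compared with `z` gives at least `c - c/8 - c/8`.
  linarith

end ComparisonPrinciple

end TataruHJ

theorem theorem5p2 {E : Type*} [NormedAddCommGroup E] [InnerProductSpace ℝ E] [CompleteSpace E]
    [TopologicalSpace.SeparableSpace E]
    (C : Set (E × E)) (hC : TataruHJ.IsMDissipative C)
    (hdense : Dense (TataruHJ.domain C)) (hzero : ((0 : E), (0 : E)) ∈ C)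
    (G : E → E → ℝ) (hG : TataruHJ.StructuralCondition G)
    (α : ℝ) (hα : 0 < α)
    (h : E → ℝ) (hbdd : ∃ K : ℝ, ∀ x, |h x| ≤ K) (hunif : UniformContinuous h)
    (fbar funder : E → ℝ)
    (hsub : TataruHJ.IsSubsolution (TataruHJ.H₀hat C G) α h fbar)
    (hsuper : TataruHJ.IsSupersolution (TataruHJ.H₁hat C G) α h funder) :
    ∀ x, fbar x ≤ funder x :=
  TataruHJ.comparison hC hdense hzero hG hα hbdd hunif hsub hsuper
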